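/- Let $J^6$ be the jet space with real coordinates $Z,R$ and complex coordinates $W,s$ (a star denotes complex conjugation), and let $S$ be a smooth complex function of $(Z,W,W^*,R,s,s^*)$ on an open set $U\subseteq J^6$ with $1-S_RS^*_R>0$. It defines the pair of PDEs $Z_{ss}=S$, $Z_{s^*s^*}=S^*$ with $W=Z_s$, $W^*=Z_{s^*}$, $R=Z_{ss^*}$. Put $$T=\frac{S_{s^*}+W^*S_Z+RS_W+S^*S_{W^*}+S_R(S^*_s+WS^*_Z+SS^*_W+RS^*_{W^*})}{1-S_RS^*_R},$$ $$DH=H_s+WH_Z+SH_W+RH_{W^*}+TH_R,\qquad D^*H=H_{s^*}+W^*H_Z+RH_W+S^*H_{W^*}+T^*H_R,$$ (so $T=D^*S$) and assume the integrability condition $D^2S^*=D^{*2}S$. Let $\beta^0=dZ-W\,ds-W^*ds^*$, $\beta^+=dW-S\,ds-R\,ds^*$, $\beta^-=dW^*-R\,ds-S^*ds^*$, $\beta^1=dR-T\,ds-T^*ds^*$, and $$\theta^0=\Phi\beta^0,\quad \theta^+=\Phi\alpha(\beta^++b\beta^-),\quad \theta^-=\Phi\alpha(\beta^-+b^*\beta^+),\quad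 \theta^1=\Phi(\beta^1+a\beta^++a^*\beta^-+c\beta^0),$$ with smooth parameters $\alpha,c,\Phi$ (real) and $a,b$ (complex) on $U$ such that $\alpha\neq0$, $\Phi\ne0$, $bb^*\neq1$. Let $\eta$ be the constant symmetric matrix with $\eta_{01}=1$, $\eta_{+-}=-1$ and all other independent entries zero; indices $i,j,k,\dots$ run over $0,1,+,-$ and are moved with $\eta$; $J,K$ run also over $s,s^*$, with $\theta^s=ds$, $\theta^{s^*}=ds^*$. Write $d\theta^i=\frac12\Delta^i{}_{JK}\theta^J\wedge\theta^K$ with $\Delta^i{}_{JK}=-\Delta^i{}_{KJ}$. Suppose that on $U$ there is a torsion-free generalized Weyl connection, i.e. one-forms $\omega_{ij}$ and $A$ with $d\theta^i+\omega^i{}_j\wedge\theta^j=0$ and $\omega_{(ij)}=\eta_{ij}A$. Then: 1. For every choice of the four functions $A_i$ there is exactly one torsion-free generalized Weyl connection whose Weyl form has the form $A=A_i\theta^i+A_sds+A_{s^*}ds^*$. It is given by $A_s=\frac14\Delta^k{}_{ks}$, $A_{s^*}=\frac14\Delta^k{}_{ks^*}$ and $\omega_{ij}=\omega_{ijk}\theta^k+\Delta_{ijs}ds+\Delta_{ijs^*}ds^*$,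 where $$\omega_{ijk}=\eta_{ij}A_k-\eta_{jk}A_i+\eta_{ki}A_j+\tfrac12(\Delta_{ijk}-\Delta_{kij}+\Delta_{jki}).$$ 2. The tetrad parameters are determined by $S,S^*$ (up to the sign of $\alpha$ and the choice of the root $b$). At each point $b$ is one of the two roots $(-1\pm\sqrt{1-S_RS^*_R})/S^*_R$ if $S_R\neq0$, and $b=0$ if $S_R=0$; where $|b|<1$ (the branch that vanishes with $S$) it is $$b=b_+:=\frac{-1+\sqrt{1-S_RS^*_R}}{S^*_R}\qquad(b_+=0\text{ where }S_R=0).$$ Moreover $$\alpha^2=\frac{1+bb^*}{(1-bb^*)^2},$$ $$a=\frac{(1+bb^*)\left[b^{*2}Db+Db^*+D^*(bb^*)+(1-bb^*)(b^*S_W+bS^*_W)\right]}{(1-bb^*)^3},$$ which where $b\neq0$ is also equal to $$a=\frac{(1+bb^*)\{b^{*2}(-Db+bS_W-S_{W^*})+b(-D^*b^*+b^*S^*_{W^*}-S^*_W)\}}{bb^*(1-bb^*)^2},$$ and $$c=-\frac{Da+D^*a^*+T_W+T^*_{W^*}}4-\frac{aa^*(1+6bb^*+b^2b^{*2})}{2(1+bb^*)^2}+\frac{(1+bb^*)(bS^*_Z+b^*S_Z)}{2(1-bb^*)^2}+\frac{a(2ab-b^*S_{W^*})+a^*(2a^*b^*-bS^*_W)}{2(1+bb^*)}.$$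 3. The generalized Wünschmann invariant of $S,S^*$ vanishes on $U$: with $b=b_+$, $$M[S,S^*]=\frac{Db+bD^*b+S_{W^*}-bS_W+b^2S^*_{W^*}-b^3S^*_W}{1-bb^*}=0.$$ -/

import Mathlib

open scoped ContDiff ComplexConjugate

noncomputable section

namespace PairPDE

/-- The jet space of pairs of second order PDEs. Its points are `(Z, W, R, s)` with `Z`, `R` real and
`W`, `s` complex; the remaining two coordinates are the complex conjugates of `W` and `s`. -/
abbrev J6 : Type := ℝ × ℂ × ℝ × ℂ

/-- The coordinates `W`, `R` as complex-valued functions (the conjugate of `W` is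
`conj (cW p)`). -/
def cW (p : J6) : ℂ := p.2.1

def cR (p : J6) : ℂ := (p.2.2.1 : ℂ)

/-! Partial derivatives of complex-valued functions; those with respect to the complex coordinates
and their conjugates are Wirtinger derivatives. -/

/-- The partial derivative with respect to `Z`. -/
def pdZ (f : J6 → ℂ) (p : J6) : ℂ := fderiv ℝ f p (1, 0, 0, 0)

/-- The partial derivative with respect to `R`. -/
def pdR (f : J6 → ℂ) (p : J6) : ℂ := fderiv ℝ f p (0, 0, 1, 0)

/-- The partial derivative with respect to `W`. -/
def pdW (f : J6 → ℂ) (p : J6) : ℂ :=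
  (fderiv ℝ f p (0, 1, 0, 0) - Complex.I * fderiv ℝ f p (0, Complex.I, 0, 0)) / 2

/-- The partial derivative with respect to the conjugate of `W`. -/
def pdWc (f : J6 → ℂ) (p : J6) : ℂ :=
  (fderiv ℝ f p (0, 1, 0, 0) + Complex.I * fderiv ℝ f p (0, Complex.I, 0, 0)) / 2

/-- The partial derivative with respect to `s`. -/
def pds (f : J6 → ℂ) (p : J6) : ℂ :=
  (fderiv ℝ f p (0, 0, 0, 1) - Complex.I * fderiv ℝ f p (0, 0, 0, Complex.I)) / 2

/-- The partial derivative with respect to the conjugate of `s`. -/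
def pdsc (f : J6 → ℂ) (p : J6) : ℂ :=
  (fderiv ℝ f p (0, 0, 0, 1) + Complex.I * fderiv ℝ f p (0, 0, 0, Complex.I)) / 2

/-- The pointwise complex conjugate of a function. -/
def cc (f : J6 → ℂ) (p : J6) : ℂ := conj (f p)

/-- A real function as a complex-valued function. -/
def toC (f : J6 → ℝ) (p : J6) : ℂ := (f p : ℂ)

/-- The function `T`, the solution of `T = D* S`, `T* = D S*`. -/
def T (S : J6 → ℂ) (p : J6) : ℂ :=
  (pdsc S p + conj (cW p) * pdZ S p + cR p * pdW S p + cc S p * pdWc S p)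
      / (1 - pdR S p * pdR (cc S) p)
    + pdR S p *
      (pds (cc S) p + cW p * pdZ (cc S) p + S p * pdW (cc S) p + cR p * pdWc (cc S) p)
      / (1 - pdR S p * pdR (cc S) p)

/-- The total derivative `D = d/ds`. -/
def D (S H : J6 → ℂ) (p : J6) : ℂ :=
  pds H p + cW p * pdZ H p + S p * pdW H p + cR p * pdWc H p + T S p * pdR H p

/-- The total derivative `D* = d/ds*`. -/
def Dc (S H : J6 → ℂ) (p : J6) : ℂ :=
  pdsc H p + conj (cW p) * pdZ H p + cR p * pdW H p + cc S p * pdWc H p + cc (T S) p * pdR H p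

/-! Complex-valued differential forms on the real manifold `J6`. -/

/-- Complex-valued one-forms. -/
abbrev OneForm : Type := J6 → (J6 →L[ℝ] ℂ)

/-- The exterior derivative of a one-form, evaluated at `p` on the vectors `u`, `v`. -/
def extD (θ : OneForm) (p u v : J6) : ℂ := fderiv ℝ θ p u v - fderiv ℝ θ p v u

/-- `extD` is the exterior derivative of the library. -/
theorem extD_eq_extDeriv (θ : OneForm) (p u v : J6) (h : DifferentiableAt ℝ θ p) :
    extDeriv (fun x => ContinuousAlternatingMap.ofSubsingleton ℝ J6 ℂ (0 : Fin 1) (θ x)) p ![u, v]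
      = extD θ p u v := by
  have h1 : DifferentiableAt ℝ
      (fun x => ContinuousAlternatingMap.ofSubsingleton ℝ J6 ℂ (0 : Fin 1) (θ x)) p :=
    ((ContinuousAlternatingMap.ofSubsingletonLIE (𝕜 := ℝ) (E := J6) (F := ℂ)
      (0 : Fin 1)).toContinuousLinearEquiv.differentiableAt).comp p h
  have h2 : ∀ w z : J6, fderiv ℝ (fun x => θ x w) p z = fderiv ℝ θ p z w := by
    intro w z
    rw [fderiv_clm_apply h (differentiableAt_const w)]
    simp
  rw [extDeriv_apply h1]
  simp [Fin.sum_univ_two, Fin.removeNth, h2, extD, sub_eq_add_neg]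

/-- The wedge product of two covectors, evaluated on the vectors `u`, `v`. -/
def wedge (φ ψ : J6 →L[ℝ] ℂ) (u v : J6) : ℂ := φ u * ψ v - φ v * ψ u

/-- The coordinate covectors `dZ`, `dW`, `dW*`, `dR`, `ds`, `ds*`. -/
def dZ : J6 →L[ℝ] ℂ := Complex.ofRealCLM ∘L ContinuousLinearMap.fst ℝ ℝ (ℂ × ℝ × ℂ)

def dW : J6 →L[ℝ] ℂ :=
  ContinuousLinearMap.fst ℝ ℂ (ℝ × ℂ) ∘L ContinuousLinearMap.snd ℝ ℝ (ℂ × ℝ × ℂ)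

def dWc : J6 →L[ℝ] ℂ := (Complex.conjCLE : ℂ →L[ℝ] ℂ) ∘L dW

def dR : J6 →L[ℝ] ℂ :=
  Complex.ofRealCLM ∘L ContinuousLinearMap.fst ℝ ℝ ℂ ∘L ContinuousLinearMap.snd ℝ ℂ (ℝ × ℂ) ∘L
    ContinuousLinearMap.snd ℝ ℝ (ℂ × ℝ × ℂ)

def ds : J6 →L[ℝ] ℂ :=
  ContinuousLinearMap.snd ℝ ℝ ℂ ∘L ContinuousLinearMap.snd ℝ ℂ (ℝ × ℂ) ∘L
    ContinuousLinearMap.snd ℝ ℝ (ℂ × ℝ × ℂ)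

def dsc : J6 →L[ℝ] ℂ := (Complex.conjCLE : ℂ →L[ℝ] ℂ) ∘L ds

/-- The Pfaffian system whose vanishing is equivalent to the pair of PDEs. -/
def β0 : OneForm := fun p => dZ - cW p • ds - conj (cW p) • dsc

def βp (S : J6 → ℂ) : OneForm := fun p => dW - S p • ds - cR p • dsc

def βm (S : J6 → ℂ) : OneForm := fun p => dWc - cR p • ds - cc S p • dsc

def β1 (S : J6 → ℂ) : OneForm := fun p => dR - T S p • ds - cc (T S) p • dsc

/-- The tetrad parameters `α`, `b`, `a`, `c` (with `b*`, `a*` the conjugates of `b`, `a`) and the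
conformal parameter `Φ`. -/
structure TetradParams where
  α : J6 → ℝ
  b : J6 → ℂ
  a : J6 → ℂ
  c : J6 → ℝ
  Φ : J6 → ℝ

/-- The parameters are smooth on `U`, and the four one-forms built from them are
linearly independent there. -/
structure TetradParams.IsAdmissible (q : TetradParams) (U : Set J6) : Prop where
  smooth_α : ContDiffOn ℝ ∞ q.α U
  smooth_b : ContDiffOn ℝ ∞ q.b U
  smooth_a : ContDiffOn ℝ ∞ q.a U
  smooth_c : ContDiffOn ℝ ∞ q.c U
  smooth_Φ : ContDiffOn ℝ ∞ q.Φ U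
  α_ne : ∀ p ∈ U, q.α p ≠ 0
  Φ_ne : ∀ p ∈ U, q.Φ p ≠ 0
  b_ne : ∀ p ∈ U, q.b p * conj (q.b p) ≠ 1

/-- The null tetrad. The indices `0, 1, 2, 3` stand for `0, 1, +, -`. -/
def tetrad (S : J6 → ℂ) (q : TetradParams) : Fin 4 → OneForm :=
  ![fun p => toC q.Φ p • β0 p,
    fun p => toC q.Φ p •
      (β1 S p + q.a p • βp S p + conj (q.a p) • βm S p + toC q.c p • β0 p),
    fun p => (toC q.Φ p * toC q.α p) • (βp S p + q.b p • βm S p),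
    fun p => (toC q.Φ p * toC q.α p) • (βm S p + conj (q.b p) • βp S p)]

/-- The coframe on `J6`: the null tetrad followed by `ds` and `ds*` (indices `4`, `5`). -/
def coframe (S : J6 → ℂ) (q : TetradParams) : Fin 6 → OneForm :=
  ![tetrad S q 0, tetrad S q 1, tetrad S q 2, tetrad S q 3, fun _ => ds, fun _ => dsc]

/-- A tetrad index as an index of the coframe. -/
def up (i : Fin 4) : Fin 6 := Fin.castLE (by norm_num) i

/-- The flat metric in the null tetrad, in the index order `0, 1, +, -`; it is its own inverse. -/
def η : Matrix (Fin 4) (Fin 4) ℂ :=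
  !![0, 1, 0, 0; 1, 0, 0, 0; 0, 0, 0, -1; 0, 0, -1, 0]

theorem η_mul_η : η * η = 1 := by
  ext i j
  fin_cases i <;> fin_cases j <;> simp [η, Matrix.mul_apply, Fin.sum_univ_four]

/-- `Γ i j` (lower indices) is a torsion-free generalized Weyl connection on `U` for the coframe
`θ`, with Weyl one-form `A`: the first structure equation holds without torsion, and the
symmetric part of `Γ` is `η A`. The upper index of `Γ` is raised with `η`, which is its own inverse (`η_mul_η`). -/
structure IsTorsionFreeWeyl (U : Set J6) (θ : Fin 4 → OneForm) (Γ : Fin 4 → Fin 4 → OneForm)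
    (A : OneForm) : Prop where
  torsion_free : ∀ p ∈ U, ∀ i : Fin 4, ∀ u v : J6,
    extD (θ i) p u v + ∑ j, wedge (∑ k, η i k • Γ k j p) (θ j p) u v = 0
  weyl : ∀ p ∈ U, ∀ i j : Fin 4, (1 / 2 : ℂ) • (Γ i j p + Γ j i p) = η i j • A p

/-- `Δ i J K` are the coefficients, skew in `J K`, of the exterior derivatives of the tetrad:
`dθ^i = (1/2) Δ^i_{JK} θ^J ∧ θ^K`. -/
structure IsStructureCoeff (U : Set J6) (S : J6 → ℂ) (q : TetradParams)
    (Δ : Fin 4 → Fin 6 → Fin 6 → J6 → ℂ) : Prop where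
  smooth : ∀ i J K, ContDiffOn ℝ ∞ (Δ i J K) U
  skew : ∀ p ∈ U, ∀ i J K, Δ i J K p = -Δ i K J p
  expand : ∀ p ∈ U, ∀ i : Fin 4, ∀ u v : J6,
    extD (tetrad S q i) p u v =
      (1 / 2) * ∑ J, ∑ K, Δ i J K p * wedge (coframe S q J p) (coframe S q K p) u v

/-- `Δ` with its first index lowered by `η`. -/
def lowerΔ (Δ : Fin 4 → Fin 6 → Fin 6 → J6 → ℂ) (i : Fin 4) (J K : Fin 6) (p : J6) : ℂ :=
  ∑ l, η i l * Δ l J K p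

/-- `A4 i` are the space-time components `A_i` of the one-form `A = A_I θ^I` on `U`; the fiber
components are left free. -/
def HasSpacetimePart (U : Set J6) (S : J6 → ℂ) (q : TetradParams) (A : OneForm)
    (A4 : Fin 4 → J6 → ℂ) : Prop :=
  ∀ p ∈ U, ∃ x y : ℂ, A p = ∑ i, A4 i p • tetrad S q i p + x • ds + y • dsc

/-- The Weyl one-form with space-time components `A4` and the fiber components
`A_s = Δ^k_{ks} / 4`, `A_{s*} = Δ^k_{ks*} / 4`. -/
def weylForm (S : J6 → ℂ) (q : TetradParams) (Δ : Fin 4 → Fin 6 → Fin 6 → J6 → ℂ)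
    (A4 : Fin 4 → J6 → ℂ) : OneForm := fun p =>
  ∑ i, A4 i p • tetrad S q i p + ((1 / 4) * ∑ k, Δ k (up k) 4 p) • ds
    + ((1 / 4) * ∑ k, Δ k (up k) 5 p) • dsc

/-- The tetrad components `Γ_{ijk}` of the connection. -/
def connCoeff (Δ : Fin 4 → Fin 6 → Fin 6 → J6 → ℂ) (A4 : Fin 4 → J6 → ℂ) (i j k : Fin 4)
    (p : J6) : ℂ :=
  η i j * A4 k p - η j k * A4 i p + η k i * A4 j p
    + (1 / 2) * (lowerΔ Δ i (up j) (up k) p - lowerΔ Δ k (up i) (up j) p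
      + lowerΔ Δ j (up k) (up i) p)

/-- The connection one-forms with tetrad components `connCoeff` and fiber components
`Γ_{ijs} = Δ_{ijs}`, `Γ_{ijs*} = Δ_{ijs*}`. -/
def connForm (S : J6 → ℂ) (q : TetradParams) (Δ : Fin 4 → Fin 6 → Fin 6 → J6 → ℂ)
    (A4 : Fin 4 → J6 → ℂ) (i j : Fin 4) : OneForm := fun p =>
  ∑ k, connCoeff Δ A4 i j k p • tetrad S q k p + lowerΔ Δ i (up j) 4 p • ds
    + lowerΔ Δ i (up j) 5 p • dsc

/-- The square root of `1 - S_R S*_R`, where `S*_R` is the conjugate of `S_R`. -/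
def rootS (S : J6 → ℂ) (p : J6) : ℂ := (Real.sqrt (1 - Complex.normSq (pdR S p)) : ℂ)

/-- `b = (-1 + √(1 - S_R S*_R)) / S*_R`. Where `S_R = 0` this is `0`, the value of its continuous
extension; see `bPlus_eq`. -/
def bPlus (S : J6 → ℂ) (p : J6) : ℂ := (-1 + rootS S p) / conj (pdR S p)

/-- The other root `(-1 - √(1 - S_R S*_R)) / S*_R`, meaningful only where `S_R ≠ 0`. -/
def bMinus (S : J6 → ℂ) (p : J6) : ℂ := (-1 - rootS S p) / conj (pdR S p)

theorem bPlus_eq (S : J6 → ℂ) (p : J6) (h : 0 < 1 - Complex.normSq (pdR S p)) :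
    bPlus S p = -pdR S p / (1 + rootS S p) := by
  have h0 : 0 ≤ Real.sqrt (1 - Complex.normSq (pdR S p)) := Real.sqrt_nonneg _
  have h1 : (1 + rootS S p) ≠ 0 := by
    unfold rootS
    exact_mod_cast (by positivity : (1 + Real.sqrt (1 - Complex.normSq (pdR S p))) ≠ 0)
  have h2 : rootS S p ^ 2 = 1 - pdR S p * conj (pdR S p) := by
    rw [Complex.mul_conj]
    unfold rootS
    exact_mod_cast Real.sq_sqrt h.le
  unfold bPlus
  by_cases hz : pdR S p = 0
  · simp [hz]
  · have h3 : conj (pdR S p) ≠ 0 := by simpa using hz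
    rw [div_eq_div_iff h3 h1]
    linear_combination h2

/-- The generalized Wünschmann expression built from `S` and a function `b`. -/
def wunschmann (S b : J6 → ℂ) (p : J6) : ℂ :=
  (D S b p + b p * Dc S b p + pdWc S p - b p * pdW S p + b p ^ 2 * pdWc (cc S) p
      - b p ^ 3 * pdW (cc S) p) / (1 - b p * conj (b p))

/-- The explicit value of the parameter `a`, in a form that is regular also where `b = 0`. -/
def aRegular (S b : J6 → ℂ) (p : J6) : ℂ :=
  (1 + b p * conj (b p)) *
    (conj (b p) ^ 2 * D S b p + D S (cc b) p + Dc S (fun x => b x * cc b x) p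
      + (1 - b p * conj (b p)) * (conj (b p) * pdW S p + b p * pdW (cc S) p))
    / (1 - b p * conj (b p)) ^ 3

/-- The explicit value of the parameter `a` where `b ≠ 0`. -/
def aFormula (S b : J6 → ℂ) (p : J6) : ℂ :=
  (b p)⁻¹ * (conj (b p))⁻¹ * ((1 - b p * conj (b p)) ^ 2)⁻¹ * (1 + b p * conj (b p)) *
    (conj (b p) ^ 2 * (-D S b p + b p * pdW S p - pdWc S p)
      + b p * (-Dc S (cc b) p + conj (b p) * pdWc (cc S) p - pdW (cc S) p))

/-- The explicit value of the parameter `c`. -/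
def cFormula (S b a : J6 → ℂ) (p : J6) : ℂ :=
  -(D S a p + Dc S (cc a) p + pdW (T S) p + pdWc (cc (T S)) p) / 4
    - a p * conj (a p) * (1 + 6 * (b p * conj (b p)) + (b p * conj (b p)) ^ 2)
      / (2 * (1 + b p * conj (b p)) ^ 2)
    + (1 + b p * conj (b p)) * (b p * pdZ (cc S) p + conj (b p) * pdZ S p)
      / (2 * (1 - b p * conj (b p)) ^ 2)
    + (a p * (2 * a p * b p - conj (b p) * pdWc S p)
        + conj (a p) * (2 * conj (a p) * conj (b p) - b p * pdW (cc S) p))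
      / (2 * (1 + b p * conj (b p)))

end PairPDE

end

open scoped ContDiff ComplexConjugate
open PairPDE

open scoped ContDiff ComplexConjugate
open PairPDE

namespace PairPDE

/-! Everything is read off from the first structure equation, written in components in the coframe
`θ^i, ds, ds*`.

The connection. The components along two tetrad directions, together with `ω_(ij) = η_ij A`, give a
Koszul-type formula for `ω_ijk`. The components with one fiber direction give `ω_ijs = Δ_ijs`, whose
trace is `4 A_s`, and likewise for `s*`. What is left constrains `Δ` alone: `Δ_iss* = 0`, and the
symmetric parts of `Δ_ijs` and `Δ_ijs*` are multiples of `η_ij`. These hold as soon as one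
connection exists, so the `A_i` remain free (`isWeylSystem_iff`, `weyl_connection_unique`).

The parameters. The field `D` annihilates the tetrad, so contraction gives `L_D θ^i = -ω^i_j(D)
θ^j`, and the degenerate metric `2θ^0θ^1 - 2θ^+θ^-` is rescaled by `-2A(D)` along `D`
(`conformal_along_D`). Comparing coefficients of these quadratic forms on vertical vectors yields
`FiberEquations`. The two mixed coefficients involving `R` give `(1 + bb*) S_R = -2b` and `α²`. The
coefficients in `W, W*` contain an unknown factor `l`. Eliminating it and adjoining complex
conjugates leaves an overdetermined linear system for `a, a*` (`fiber_elimination`,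
`fiber_solution`). Its consistency condition is `M = b³M*`, whence `M = (bb*)³M` and `M = 0`,
because `bb* ≠ 1`. Then `a` and `l` can be read off, and the `ZW` coefficient averaged with its
conjugate gives `c`.

The branch. Where `|b| > 1` one has `b_+ = 1/b*`. This substitution only exchanges `θ^+` and `θ^-`
up to scale, and it turns `M` into a multiple of its conjugate (`wunschmann_inv_conj`). -/

/-! ### Complexified tangent vectors -/

/-- A real basis of the tangent space of the jet space. -/
def vec : Fin 6 → J6 :=
  ![(1, 0, 0, 0), (0, 0, 1, 0), (0, 1, 0, 0), (0, Complex.I, 0, 0), (0, 0, 0, 1),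
    (0, 0, 0, Complex.I)]

/-- The components, with respect to `vec`, of the complexified tangent vector
`z ∂_Z + r ∂_R + w ∂_W + w' ∂_{W*} + t ∂_s + t' ∂_{s*}`. -/
noncomputable def coordVec (z r w w' t t' : ℂ) : Fin 6 → ℂ :=
  ![z, r, (w + w') / 2, Complex.I * (w' - w) / 2, (t + t') / 2, Complex.I * (t' - t) / 2]

/-- The value of a function on a complexified tangent vector, by complex linear extension. -/
def cev (E : Fin 6 → ℂ) (F : J6 → ℂ) : ℂ := ∑ m, E m * F (vec m)

/-- The value of a function of two vectors on complexified tangent vectors. -/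
def cev2 (E E' : Fin 6 → ℂ) (B : J6 → J6 → ℂ) : ℂ := ∑ m, ∑ n, E m * E' n * B (vec m) (vec n)

theorem vec_span (v : J6) :
    v = v.1 • vec 0 + v.2.2.1 • vec 1 + v.2.1.re • vec 2 + v.2.1.im • vec 3
      + v.2.2.2.re • vec 4 + v.2.2.2.im • vec 5 := by
  obtain ⟨z, w, r, s⟩ := v
  simp only [vec]
  ext <;> simp

theorem isLinearMap_ext {f g : J6 → ℂ} (hf : IsLinearMap ℝ f) (hg : IsLinearMap ℝ g)
    (h : ∀ m, f (vec m) = g (vec m)) (v : J6) : f v = g v := by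
  rw [vec_span v]
  simp only [hf.map_add, hf.map_smul, hg.map_add, hg.map_smul, h]

theorem cev_add (E : Fin 6 → ℂ) (F G : J6 → ℂ) :
    cev E (fun v => F v + G v) = cev E F + cev E G := by
  simp [cev, mul_add, Finset.sum_add_distrib]

theorem cev_const_mul (E : Fin 6 → ℂ) (k : ℂ) (F : J6 → ℂ) :
    cev E (fun v => k * F v) = k * cev E F := by
  simp only [cev, Finset.mul_sum]
  exact Finset.sum_congr rfl fun m _ => by ring

theorem cev_sum {ι : Type*} (t : Finset ι) (E : Fin 6 → ℂ) (F : ι → J6 → ℂ) :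
    cev E (fun v => ∑ i ∈ t, F i v) = ∑ i ∈ t, cev E (F i) := by
  simp only [cev, Finset.mul_sum]
  exact Finset.sum_comm

theorem cev2_add (E E' : Fin 6 → ℂ) (F G : J6 → J6 → ℂ) :
    cev2 E E' (fun u v => F u v + G u v) = cev2 E E' F + cev2 E E' G := by
  simp [cev2, mul_add, Finset.sum_add_distrib]

theorem cev2_const_mul (E E' : Fin 6 → ℂ) (k : ℂ) (F : J6 → J6 → ℂ) :
    cev2 E E' (fun u v => k * F u v) = k * cev2 E E' F := by
  simp only [cev2, Finset.mul_sum]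
  exact Finset.sum_congr rfl fun m _ => Finset.sum_congr rfl fun n _ => by ring

theorem cev2_eq (E E' : Fin 6 → ℂ) (B : J6 → J6 → ℂ) :
    cev2 E E' B = cev E (fun u => cev E' (B u)) := by
  simp only [cev2, cev, Finset.mul_sum, mul_assoc]

theorem cev2_sum {ι : Type*} (t : Finset ι) (E E' : Fin 6 → ℂ) (F : ι → J6 → J6 → ℂ) :
    cev2 E E' (fun u v => ∑ i ∈ t, F i u v) = ∑ i ∈ t, cev2 E E' (F i) := by
  simp only [cev2_eq, cev_sum]

theorem cev2_wedge (E E' : Fin 6 → ℂ) (φ ψ : J6 →L[ℝ] ℂ) :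
    cev2 E E' (wedge φ ψ) = cev E φ * cev E' ψ - cev E' φ * cev E ψ := by
  simp only [cev2, cev, wedge, Finset.sum_mul_sum]
  rw [Finset.sum_comm (f := fun i j => E' i * φ (vec i) * (E j * ψ (vec j)))]
  simp only [← Finset.sum_sub_distrib]
  exact Finset.sum_congr rfl fun m _ => Finset.sum_congr rfl fun n _ => by ring

theorem cev2_swap (E E' : Fin 6 → ℂ) (B : J6 → J6 → ℂ) :
    cev2 E E' B = cev2 E' E (fun u v => B v u) := by
  simp only [cev2]
  rw [Finset.sum_comm]
  exact Finset.sum_congr rfl fun m _ => Finset.sum_congr rfl fun n _ => by ring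

section coordinates
variable (z r w w' t t' : ℂ)

theorem cev_coordVec (F : J6 → ℂ) : cev (coordVec z r w w' t t') F =
    z * F (1, 0, 0, 0) + r * F (0, 0, 1, 0)
      + w * ((F (0, 1, 0, 0) - Complex.I * F (0, Complex.I, 0, 0)) / 2)
      + w' * ((F (0, 1, 0, 0) + Complex.I * F (0, Complex.I, 0, 0)) / 2)
      + t * ((F (0, 0, 0, 1) - Complex.I * F (0, 0, 0, Complex.I)) / 2)
      + t' * ((F (0, 0, 0, 1) + Complex.I * F (0, 0, 0, Complex.I)) / 2) := by
  simp only [cev, coordVec, vec, Fin.sum_univ_six]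
  simp
  ring

theorem cev_coordVec_fderiv (H : J6 → ℂ) (p : J6) :
    cev (coordVec z r w w' t t') (fderiv ℝ H p) =
      z * pdZ H p + r * pdR H p + w * pdW H p + w' * pdWc H p + t * pds H p + t' * pdsc H p := by
  rw [cev_coordVec]
  rfl

theorem cev_dZ : cev (coordVec z r w w' t t') dZ = z := by
  rw [cev_coordVec]; simp [dZ]

theorem cev_dR : cev (coordVec z r w w' t t') dR = r := by
  rw [cev_coordVec]; simp [dR]

theorem cev_dW : cev (coordVec z r w w' t t') dW = w := by
  rw [cev_coordVec]; simp [dW]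

theorem cev_dWc : cev (coordVec z r w w' t t') dWc = w' := by
  rw [cev_coordVec]; simp [dWc, dW]

theorem cev_ds : cev (coordVec z r w w' t t') ds = t := by
  rw [cev_coordVec]; simp [ds]

theorem cev_dsc : cev (coordVec z r w w' t t') dsc = t' := by
  rw [cev_coordVec]; simp [dsc, ds]

end coordinates

theorem cev_clm_add (E : Fin 6 → ℂ) (φ ψ : J6 →L[ℝ] ℂ) :
    cev E (φ + ψ : J6 →L[ℝ] ℂ) = cev E φ + cev E ψ := cev_add E φ ψ

theorem cev_clm_sub (E : Fin 6 → ℂ) (φ ψ : J6 →L[ℝ] ℂ) :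
    cev E (φ - ψ : J6 →L[ℝ] ℂ) = cev E φ - cev E ψ := by
  simp [cev, mul_sub, Finset.sum_sub_distrib]

theorem cev_clm_smul (E : Fin 6 → ℂ) (k : ℂ) (φ : J6 →L[ℝ] ℂ) :
    cev E (k • φ : J6 →L[ℝ] ℂ) = k * cev E φ := cev_const_mul E k φ

theorem cev_clm_sum {ι : Type*} (t : Finset ι) (E : Fin 6 → ℂ) (φ : ι → J6 →L[ℝ] ℂ) :
    cev E (∑ i ∈ t, φ i : J6 →L[ℝ] ℂ) = ∑ i ∈ t, cev E (φ i) := by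
  rw [← cev_sum]
  congr 1
  ext v
  simp

/-! ### Partial derivatives, conjugation and smoothness -/

theorem fderiv_cc (f : J6 → ℂ) (p v : J6) : fderiv ℝ (cc f) p v = conj (fderiv ℝ f p v) := by
  have h : cc f = (Complex.conjCLE : ℂ → ℂ) ∘ f := by
    ext x; simp [cc]
  rw [h, ContinuousLinearEquiv.comp_fderiv]
  simp

theorem pdZ_cc (f : J6 → ℂ) (p : J6) : pdZ (cc f) p = conj (pdZ f p) := fderiv_cc f p _

theorem pdR_cc (f : J6 → ℂ) (p : J6) : pdR (cc f) p = conj (pdR f p) := fderiv_cc f p _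

theorem pdW_cc (f : J6 → ℂ) (p : J6) : pdW (cc f) p = conj (pdWc f p) := by
  simp [pdW, pdWc, fderiv_cc, sub_eq_add_neg, map_ofNat]

theorem pdWc_cc (f : J6 → ℂ) (p : J6) : pdWc (cc f) p = conj (pdW f p) := by
  simp [pdW, pdWc, fderiv_cc, sub_eq_add_neg, map_ofNat]

theorem pdsc_cc (f : J6 → ℂ) (p : J6) : pdsc (cc f) p = conj (pds f p) := by
  simp [pds, pdsc, fderiv_cc, sub_eq_add_neg, map_ofNat]

theorem conj_cR (p : J6) : conj (cR p) = cR p := by simp [cR]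

/-- Conjugation exchanges `D` and `D*`. All equations along `D*` are therefore obtained by
conjugating those along `D`, and only `D` needs a direct computation. -/
theorem Dc_cc (S H : J6 → ℂ) (p : J6) : Dc S (cc H) p = conj (D S H p) := by
  simp [Dc, D, pdZ_cc, pdR_cc, pdW_cc, pdWc_cc, pdsc_cc, conj_cR, cc]
  ring

theorem cc_cc (f : J6 → ℂ) : cc (cc f) = f := by ext x; simp [cc]

theorem D_cc (S H : J6 → ℂ) (p : J6) : D S (cc H) p = conj (Dc S H p) := by
  have h := Dc_cc S (cc H) p
  rw [cc_cc] at h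
  rw [h, Complex.conj_conj]

/-- The components of the vector field `D`. -/
noncomputable def vecD (S : J6 → ℂ) (p : J6) : Fin 6 → ℂ := coordVec (cW p) (T S p) (S p) (cR p) 1 0

theorem cev_vecD (S H : J6 → ℂ) (p : J6) : cev (vecD S p) (fderiv ℝ H p) = D S H p := by
  rw [vecD, cev_coordVec_fderiv, D]
  ring

/-- The components of the vector field `D*`. -/
noncomputable def vecDc (S : J6 → ℂ) (p : J6) : Fin 6 → ℂ :=
  coordVec (conj (cW p)) (cc (T S) p) (cR p) (cc S p) 0 1

theorem cev_vecDc (S H : J6 → ℂ) (p : J6) : cev (vecDc S p) (fderiv ℝ H p) = Dc S H p := by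
  rw [vecDc, cev_coordVec_fderiv, Dc]
  ring

section smooth
variable {U : Set J6} {f : J6 → ℂ}

theorem contDiffOn_fderiv_apply (hU : IsOpen U) (hf : ContDiffOn ℝ ∞ f U) (v : J6) :
    ContDiffOn ℝ ∞ (fun p => fderiv ℝ f p v) U :=
  (hf.fderiv_of_isOpen hU (by simp)).clm_apply contDiffOn_const

theorem contDiffOn_cc (hf : ContDiffOn ℝ ∞ f U) : ContDiffOn ℝ ∞ (cc f) U :=
  (Complex.conjCLE : ℂ ≃L[ℝ] ℂ).contDiff.comp_contDiffOn hf

theorem contDiffOn_toC {g : J6 → ℝ} (hg : ContDiffOn ℝ ∞ g U) : ContDiffOn ℝ ∞ (toC g) U :=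
  Complex.ofRealCLM.contDiff.comp_contDiffOn hg

theorem contDiffOn_cW : ContDiffOn ℝ ∞ cW U := dW.contDiff.contDiffOn

theorem contDiffOn_cR : ContDiffOn ℝ ∞ cR U := dR.contDiff.contDiffOn

theorem contDiffOn_conj_cW : ContDiffOn ℝ ∞ (fun p => conj (cW p)) U := contDiffOn_cc contDiffOn_cW

theorem contDiffOn_pdZ (hU : IsOpen U) (hf : ContDiffOn ℝ ∞ f U) : ContDiffOn ℝ ∞ (pdZ f) U :=
  contDiffOn_fderiv_apply hU hf _

theorem contDiffOn_pdR (hU : IsOpen U) (hf : ContDiffOn ℝ ∞ f U) : ContDiffOn ℝ ∞ (pdR f) U :=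
  contDiffOn_fderiv_apply hU hf _

theorem contDiffOn_pdW (hU : IsOpen U) (hf : ContDiffOn ℝ ∞ f U) : ContDiffOn ℝ ∞ (pdW f) U :=
  ((contDiffOn_fderiv_apply hU hf _).sub
    (contDiffOn_const.mul (contDiffOn_fderiv_apply hU hf _))).div_const 2

theorem contDiffOn_pdWc (hU : IsOpen U) (hf : ContDiffOn ℝ ∞ f U) : ContDiffOn ℝ ∞ (pdWc f) U :=
  ((contDiffOn_fderiv_apply hU hf _).add
    (contDiffOn_const.mul (contDiffOn_fderiv_apply hU hf _))).div_const 2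

theorem contDiffOn_pds (hU : IsOpen U) (hf : ContDiffOn ℝ ∞ f U) : ContDiffOn ℝ ∞ (pds f) U :=
  ((contDiffOn_fderiv_apply hU hf _).sub
    (contDiffOn_const.mul (contDiffOn_fderiv_apply hU hf _))).div_const 2

theorem contDiffOn_pdsc (hU : IsOpen U) (hf : ContDiffOn ℝ ∞ f U) : ContDiffOn ℝ ∞ (pdsc f) U :=
  ((contDiffOn_fderiv_apply hU hf _).add
    (contDiffOn_const.mul (contDiffOn_fderiv_apply hU hf _))).div_const 2

theorem contDiffOn_T {S : J6 → ℂ} (hU : IsOpen U) (hS : ContDiffOn ℝ ∞ S U)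
    (hineq : ∀ p ∈ U, 0 < 1 - Complex.normSq (pdR S p)) : ContDiffOn ℝ ∞ (T S) U := by
  have hSc := contDiffOn_cc hS
  have hden : ContDiffOn ℝ ∞ (fun p => 1 - pdR S p * pdR (cc S) p) U :=
    contDiffOn_const.sub ((contDiffOn_pdR hU hS).mul (contDiffOn_pdR hU hSc))
  have hne : ∀ p ∈ U, 1 - pdR S p * pdR (cc S) p ≠ 0 := by
    intro p hp
    rw [pdR_cc, Complex.mul_conj]
    exact_mod_cast (hineq p hp).ne'
  have hinv := hden.inv hne
  have hT : T S = fun p =>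
      (pdsc S p + conj (cW p) * pdZ S p + cR p * pdW S p + cc S p * pdWc S p)
        * (1 - pdR S p * pdR (cc S) p)⁻¹
      + pdR S p * (pds (cc S) p + cW p * pdZ (cc S) p + S p * pdW (cc S) p + cR p * pdWc (cc S) p)
        * (1 - pdR S p * pdR (cc S) p)⁻¹ := by
    ext p; simp only [T, div_eq_mul_inv]
  rw [hT]
  refine ContDiffOn.add (ContDiffOn.mul ?_ hinv) (ContDiffOn.mul ?_ hinv)
  · exact (((contDiffOn_pdsc hU hS).add (contDiffOn_conj_cW.mul (contDiffOn_pdZ hU hS))).add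
      (contDiffOn_cR.mul (contDiffOn_pdW hU hS))).add (hSc.mul (contDiffOn_pdWc hU hS))
  · exact (contDiffOn_pdR hU hS).mul
      ((((contDiffOn_pds hU hSc).add (contDiffOn_cW.mul (contDiffOn_pdZ hU hSc))).add
      (hS.mul (contDiffOn_pdW hU hSc))).add (contDiffOn_cR.mul (contDiffOn_pdWc hU hSc)))

end smooth

/-! ### The coframe, its dual frame, and expansions -/

section values
variable (S : J6 → ℂ) (q : TetradParams) (p : J6) (z r w w' t t' : ℂ)

theorem cev_β0 : cev (coordVec z r w w' t t') (β0 p) = z - cW p * t - conj (cW p) * t' := by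
  simp only [β0, cev_clm_sub, cev_clm_smul, cev_dZ, cev_ds, cev_dsc]

theorem cev_βp : cev (coordVec z r w w' t t') (βp S p) = w - S p * t - cR p * t' := by
  simp only [βp, cev_clm_sub, cev_clm_smul, cev_dW, cev_ds, cev_dsc]

theorem cev_βm : cev (coordVec z r w w' t t') (βm S p) = w' - cR p * t - cc S p * t' := by
  simp only [βm, cev_clm_sub, cev_clm_smul, cev_dWc, cev_ds, cev_dsc]

theorem cev_β1 : cev (coordVec z r w w' t t') (β1 S p) = r - T S p * t - cc (T S) p * t' := by
  simp only [β1, cev_clm_sub, cev_clm_smul, cev_dR, cev_ds, cev_dsc]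

theorem tetrad_zero : tetrad S q 0 = fun p => toC q.Φ p • β0 p := rfl

theorem tetrad_one : tetrad S q 1 = fun p => toC q.Φ p •
    (β1 S p + q.a p • βp S p + conj (q.a p) • βm S p + toC q.c p • β0 p) := rfl

theorem tetrad_two : tetrad S q 2 = fun p =>
    (toC q.Φ p * toC q.α p) • (βp S p + q.b p • βm S p) := rfl

theorem tetrad_three : tetrad S q 3 = fun p =>
    (toC q.Φ p * toC q.α p) • (βm S p + conj (q.b p) • βp S p) := rfl

theorem cev_tetrad_zero : cev (coordVec z r w w' t t') (tetrad S q 0 p) =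
    toC q.Φ p * (z - cW p * t - conj (cW p) * t') := by
  rw [tetrad_zero, cev_clm_smul, cev_β0]

theorem cev_tetrad_one : cev (coordVec z r w w' t t') (tetrad S q 1 p) =
    toC q.Φ p * ((r - T S p * t - cc (T S) p * t') + q.a p * (w - S p * t - cR p * t')
      + conj (q.a p) * (w' - cR p * t - cc S p * t')
      + toC q.c p * (z - cW p * t - conj (cW p) * t')) := by
  simp only [tetrad_one, cev_clm_smul, cev_clm_add, cev_β0, cev_β1, cev_βp, cev_βm]

theorem cev_tetrad_two : cev (coordVec z r w w' t t') (tetrad S q 2 p) =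
    toC q.Φ p * toC q.α p * ((w - S p * t - cR p * t')
      + q.b p * (w' - cR p * t - cc S p * t')) := by
  simp only [tetrad_two, cev_clm_smul, cev_clm_add, cev_βp, cev_βm]

theorem cev_tetrad_three : cev (coordVec z r w w' t t') (tetrad S q 3 p) =
    toC q.Φ p * toC q.α p * ((w' - cR p * t - cc S p * t')
      + conj (q.b p) * (w - S p * t - cR p * t')) := by
  simp only [tetrad_three, cev_clm_smul, cev_clm_add, cev_βp, cev_βm]

end values

theorem coframe_up (S : J6 → ℂ) (q : TetradParams) (i : Fin 4) :
    coframe S q (up i) = tetrad S q i := by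
  fin_cases i <;> rfl

/-- The components of the frame dual to `coframe`. -/
noncomputable def frame (S : J6 → ℂ) (q : TetradParams) (p : J6) : Fin 6 → Fin 6 → ℂ :=
  let m : ℂ := (toC q.Φ p)⁻¹
  -- The factor `1 - bb*` is the determinant of the block `(1, b; b*, 1)` expressing `θ^+, θ^-`
  -- through `β^+, β^-`.
  let n : ℂ := (toC q.Φ p * toC q.α p * (1 - q.b p * conj (q.b p)))⁻¹
  ![coordVec m (-toC q.c p * m) 0 0 0 0, coordVec 0 m 0 0 0 0,
    coordVec 0 (-(q.a p - conj (q.b p) * conj (q.a p)) * n) n (-conj (q.b p) * n) 0 0,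
    coordVec 0 (-(conj (q.a p) - q.b p * q.a p) * n) (-q.b p * n) n 0 0,
    vecD S p, vecDc S p]

theorem cev_frame_coframe (S : J6 → ℂ) (q : TetradParams) {U : Set J6} (hq : q.IsAdmissible U)
    {p : J6} (hp : p ∈ U) (J K : Fin 6) :
    cev (frame S q p J) (coframe S q K p) = if J = K then 1 else 0 := by
  have hΦ : toC q.Φ p ≠ 0 := by simpa [toC] using hq.Φ_ne p hp
  have hα : toC q.α p ≠ 0 := by simpa [toC] using hq.α_ne p hp
  have hb : 1 - q.b p * conj (q.b p) ≠ 0 := sub_ne_zero.2 (hq.b_ne p hp).symm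
  have hK : ∀ z r w w' t t' : ℂ, cev (coordVec z r w w' t t') (coframe S q K p) =
      ![cev (coordVec z r w w' t t') (tetrad S q 0 p), cev (coordVec z r w w' t t') (tetrad S q 1 p),
        cev (coordVec z r w w' t t') (tetrad S q 2 p), cev (coordVec z r w w' t t') (tetrad S q 3 p),
        cev (coordVec z r w w' t t') ds, cev (coordVec z r w w' t t') dsc] K := by
    intros
    fin_cases K <;> rfl
  simp only [cev_tetrad_zero, cev_tetrad_one, cev_tetrad_two, cev_tetrad_three, cev_ds,
    cev_dsc] at hK
  fin_cases J <;> simp only [frame, vecD, vecDc] <;> simp [hK] <;> clear hK <;>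
    fin_cases K <;> simp [-mul_eq_zero, -mul_inv_rev] <;> (try field_simp) <;> try ring

/-- `D` is tangent to the solutions of the Pfaffian system, and the tetrad is built from that
system. This is what makes the contraction of `D` with `dθ^i` a Lie derivative. -/
theorem cev_vecD_tetrad (S : J6 → ℂ) (q : TetradParams) (p : J6) (i : Fin 4) :
    cev (vecD S p) (tetrad S q i p) = 0 := by
  have h0 := cev_tetrad_zero S q p (cW p) (T S p) (S p) (cR p) 1 0
  have h1 := cev_tetrad_one S q p (cW p) (T S p) (S p) (cR p) 1 0
  have h2 := cev_tetrad_two S q p (cW p) (T S p) (S p) (cR p) 1 0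
  have h3 := cev_tetrad_three S q p (cW p) (T S p) (S p) (cR p) 1 0
  ring_nf at h0 h1 h2 h3
  fin_cases i <;> assumption

/-- A real linear function is expanded in a coframe with the values on the dual frame. -/
theorem expand_linear {e : Fin 6 → Fin 6 → ℂ} {θ : Fin 6 → J6 →L[ℝ] ℂ}
    (h : ∀ J K, cev (e J) (θ K) = if J = K then 1 else 0) {f : J6 → ℂ} (hf : IsLinearMap ℝ f)
    (u : J6) : f u = ∑ J, cev (e J) f * θ J u := by
  have h1 : (Matrix.of e) * (Matrix.of fun m K => θ K (vec m)) = 1 := by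
    ext J K
    rw [Matrix.mul_apply, Matrix.one_apply]
    exact h J K
  -- Duality says that frame matrix times coframe matrix is the identity. The product in the other
  -- order is the completeness relation needed for the expansion.
  have h2 := mul_eq_one_comm.1 h1
  have hg : IsLinearMap ℝ fun u => ∑ J, cev (e J) f * θ J u :=
    ⟨fun x y => by simp [mul_add, Finset.sum_add_distrib],
      fun k x => by
        simp only [map_smul, Finset.smul_sum]
        exact Finset.sum_congr rfl fun J _ => (mul_smul_comm k _ _)⟩
  refine isLinearMap_ext hf hg (fun n => ?_) u
  have h3 : ∀ m, ∑ J, θ J (vec n) * e J m = if n = m then 1 else 0 := by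
    intro m
    have := congrFun (congrFun h2 n) m
    rwa [Matrix.mul_apply, Matrix.one_apply] at this
  calc f (vec n) = ∑ m, (if n = m then 1 else 0) * f (vec m) := by simp
    _ = ∑ m, (∑ J, θ J (vec n) * e J m) * f (vec m) := by simp only [h3]
    _ = ∑ J, cev (e J) f * θ J (vec n) := by
      simp only [cev, Finset.sum_mul]
      rw [Finset.sum_comm]
      exact Finset.sum_congr rfl fun J _ => Finset.sum_congr rfl fun m _ => by ring

theorem expand_clm {e : Fin 6 → Fin 6 → ℂ} {θ : Fin 6 → J6 →L[ℝ] ℂ}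
    (h : ∀ J K, cev (e J) (θ K) = if J = K then 1 else 0) (φ : J6 →L[ℝ] ℂ) :
    φ = ∑ J, cev (e J) φ • θ J := by
  refine ContinuousLinearMap.ext fun u => ?_
  refine (expand_linear h (f := φ) φ.toLinearMap.isLinear u).trans ?_
  simp

/-- A real bilinear function is expanded in a coframe with the values on the dual frame. -/
theorem expand_bilinear {e : Fin 6 → Fin 6 → ℂ} {θ : Fin 6 → J6 →L[ℝ] ℂ}
    (h : ∀ J K, cev (e J) (θ K) = if J = K then 1 else 0) {B : J6 → J6 → ℂ}
    (hl : ∀ v, IsLinearMap ℝ fun u => B u v) (hr : ∀ u, IsLinearMap ℝ (B u)) (u v : J6) :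
    B u v = ∑ J, ∑ K, cev2 (e J) (e K) B * (θ J u * θ K v) := by
  rw [expand_linear h (hr u) v]
  have h1 : ∀ K, cev (e K) (B u) = ∑ J, cev2 (e J) (e K) B * θ J u := by
    intro K
    have hf : IsLinearMap ℝ fun u => cev (e K) (B u) :=
      ⟨fun x y => by simp [cev, (hl _).map_add, mul_add, Finset.sum_add_distrib],
        fun k x => by
          simp only [cev, (hl _).map_smul, Finset.smul_sum]
          exact Finset.sum_congr rfl fun J _ => (mul_smul_comm k _ _)⟩
    rw [expand_linear h hf u]
    simp only [cev2_eq]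
  simp only [h1, Finset.sum_mul]
  rw [Finset.sum_comm]
  exact Finset.sum_congr rfl fun J _ => Finset.sum_congr rfl fun m _ => by ring

theorem extD_linear_right (θ : OneForm) (p u : J6) : IsLinearMap ℝ (extD θ p u) :=
  ⟨fun x y => by simp only [extD, map_add, add_apply]; ring,
    fun k x => by simp [extD, mul_sub]⟩

theorem extD_swap (θ : OneForm) (p u v : J6) : extD θ p u v = -extD θ p v u := by
  simp [extD]

theorem extD_linear_left (θ : OneForm) (p v : J6) : IsLinearMap ℝ fun u => extD θ p u v :=
  ⟨fun x y => by simp only [extD, map_add, add_apply]; ring,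
    fun k x => by simp [extD, mul_sub]⟩

theorem wedge_linear_right (φ ψ : J6 →L[ℝ] ℂ) (u : J6) : IsLinearMap ℝ (wedge φ ψ u) :=
  ⟨fun x y => by simp only [wedge, map_add]; ring,
    fun k x => by simp only [wedge, map_smul, Complex.real_smul]; ring⟩

theorem wedge_linear_left (φ ψ : J6 →L[ℝ] ℂ) (v : J6) : IsLinearMap ℝ fun u => wedge φ ψ u v :=
  ⟨fun x y => by simp only [wedge, map_add]; ring,
    fun k x => by simp only [wedge, map_smul, Complex.real_smul]; ring⟩

/-! ### Structure coefficients -/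

section smooth
variable {U : Set J6} {S : J6 → ℂ} {q : TetradParams}

theorem contDiffOn_coordVec {z r w w' t t' : J6 → ℂ} (hz : ContDiffOn ℝ ∞ z U)
    (hr : ContDiffOn ℝ ∞ r U) (hw : ContDiffOn ℝ ∞ w U) (hw' : ContDiffOn ℝ ∞ w' U)
    (ht : ContDiffOn ℝ ∞ t U) (ht' : ContDiffOn ℝ ∞ t' U) (m : Fin 6) :
    ContDiffOn ℝ ∞ (fun p => coordVec (z p) (r p) (w p) (w' p) (t p) (t' p) m) U := by
  fin_cases m
  · exact hz
  · exact hr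
  · exact (hw.add hw').div_const 2
  · exact (contDiffOn_const.mul (hw'.sub hw)).div_const 2
  · exact (ht.add ht').div_const 2
  · exact (contDiffOn_const.mul (ht'.sub ht)).div_const 2

theorem contDiffOn_frame (hU : IsOpen U) (hS : ContDiffOn ℝ ∞ S U)
    (hineq : ∀ p ∈ U, 0 < 1 - Complex.normSq (pdR S p)) (hq : q.IsAdmissible U) (J m : Fin 6) :
    ContDiffOn ℝ ∞ (fun p => frame S q p J m) U := by
  have hT := contDiffOn_T hU hS hineq
  have hΦ := contDiffOn_toC hq.smooth_Φ
  have hα := contDiffOn_toC hq.smooth_α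
  have hc := contDiffOn_toC hq.smooth_c
  have ha := hq.smooth_a
  have hb := hq.smooth_b
  have hac := contDiffOn_cc ha
  have hbc := contDiffOn_cc hb
  have hΦ0 : ∀ p ∈ U, toC q.Φ p ≠ 0 := fun p hp => by simpa [toC] using hq.Φ_ne p hp
  have hα0 : ∀ p ∈ U, toC q.α p ≠ 0 := fun p hp => by simpa [toC] using hq.α_ne p hp
  have hb0 : ∀ p ∈ U, 1 - q.b p * conj (q.b p) ≠ 0 :=
    fun p hp => sub_ne_zero.2 (hq.b_ne p hp).symm
  have h0 : ContDiffOn ℝ ∞ (fun _ : J6 => (0 : ℂ)) U := contDiffOn_const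
  have h1 : ContDiffOn ℝ ∞ (fun _ : J6 => (1 : ℂ)) U := contDiffOn_const
  have hm := hΦ.inv hΦ0
  have hn := ((hΦ.mul hα).mul (h1.sub (hb.mul hbc))).inv
    fun p hp => mul_ne_zero (mul_ne_zero (hΦ0 p hp) (hα0 p hp)) (hb0 p hp)
  fin_cases J
  · exact contDiffOn_coordVec hm (hc.neg.mul hm) h0 h0 h0 h0 m
  · exact contDiffOn_coordVec h0 hm h0 h0 h0 h0 m
  · exact contDiffOn_coordVec h0 ((ha.sub (hbc.mul hac)).neg.mul hn) hn (hbc.neg.mul hn) h0 h0 m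
  · exact contDiffOn_coordVec h0 ((hac.sub (hb.mul ha)).neg.mul hn) (hb.neg.mul hn) hn h0 h0 m
  · exact contDiffOn_coordVec contDiffOn_cW hT hS contDiffOn_cR h1 h0 m
  · exact contDiffOn_coordVec contDiffOn_conj_cW (contDiffOn_cc hT) contDiffOn_cR
      (contDiffOn_cc hS) h0 h1 m

theorem contDiffOn_β {f g : J6 → ℂ} (φ : J6 →L[ℝ] ℂ) (hf : ContDiffOn ℝ ∞ f U)
    (hg : ContDiffOn ℝ ∞ g U) : ContDiffOn ℝ ∞ (fun p => φ - f p • ds - g p • dsc) U :=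
  (contDiffOn_const.sub (hf.smul contDiffOn_const)).sub (hg.smul contDiffOn_const)

theorem contDiffOn_tetrad (hU : IsOpen U) (hS : ContDiffOn ℝ ∞ S U)
    (hineq : ∀ p ∈ U, 0 < 1 - Complex.normSq (pdR S p)) (hq : q.IsAdmissible U) (i : Fin 4) :
    ContDiffOn ℝ ∞ (tetrad S q i) U := by
  have hT := contDiffOn_T hU hS hineq
  have h0 : ContDiffOn ℝ ∞ β0 U := contDiffOn_β _ contDiffOn_cW contDiffOn_conj_cW
  have hp : ContDiffOn ℝ ∞ (βp S) U := contDiffOn_β _ hS contDiffOn_cR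
  have hm : ContDiffOn ℝ ∞ (βm S) U := contDiffOn_β _ contDiffOn_cR (contDiffOn_cc hS)
  have h1 : ContDiffOn ℝ ∞ (β1 S) U := contDiffOn_β _ hT (contDiffOn_cc hT)
  have hΦ := contDiffOn_toC hq.smooth_Φ
  have hα := contDiffOn_toC hq.smooth_α
  fin_cases i
  · exact hΦ.smul h0
  · exact hΦ.smul (((h1.add (hq.smooth_a.smul hp)).add ((contDiffOn_cc hq.smooth_a).smul hm)).add
      ((contDiffOn_toC hq.smooth_c).smul h0))
  · exact (hΦ.mul hα).smul (hp.add (hq.smooth_b.smul hm))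
  · exact (hΦ.mul hα).smul (hm.add ((contDiffOn_cc hq.smooth_b).smul hp))

theorem contDiffOn_extD {θ : OneForm} (hU : IsOpen U) (hθ : ContDiffOn ℝ ∞ θ U) (u v : J6) :
    ContDiffOn ℝ ∞ (fun p => extD θ p u v) U :=
  (((hθ.fderiv_of_isOpen hU (by simp)).clm_apply contDiffOn_const).clm_apply contDiffOn_const).sub
    (((hθ.fderiv_of_isOpen hU (by simp)).clm_apply contDiffOn_const).clm_apply contDiffOn_const)

end smooth

/-- The structure coefficients of the tetrad. -/
noncomputable def structureCoeff (S : J6 → ℂ) (q : TetradParams) (i : Fin 4) (J K : Fin 6)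
    (p : J6) : ℂ :=
  cev2 (frame S q p J) (frame S q p K) (extD (tetrad S q i) p)

theorem structureCoeff_skew (S : J6 → ℂ) (q : TetradParams) (i : Fin 4) (J K : Fin 6) (p : J6) :
    structureCoeff S q i J K p = -structureCoeff S q i K J p := by
  rw [structureCoeff, structureCoeff, cev2_swap, ← neg_one_mul, ← cev2_const_mul]
  simp only [neg_one_mul, ← extD_swap]

theorem lowerΔ_structureCoeff_skew (S : J6 → ℂ) (q : TetradParams) (i : Fin 4) (J K : Fin 6)
    (p : J6) : lowerΔ (structureCoeff S q) i J K p = -lowerΔ (structureCoeff S q) i K J p := by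
  simp only [lowerΔ, ← Finset.sum_neg_distrib]
  exact Finset.sum_congr rfl fun l _ => by rw [structureCoeff_skew]; ring

theorem isStructureCoeff {U : Set J6} {S : J6 → ℂ} {q : TetradParams} (hU : IsOpen U)
    (hS : ContDiffOn ℝ ∞ S U) (hineq : ∀ p ∈ U, 0 < 1 - Complex.normSq (pdR S p))
    (hq : q.IsAdmissible U) : IsStructureCoeff U S q (structureCoeff S q) where
  smooth i J K := by
    have hf := fun J m => contDiffOn_frame hU hS hineq hq J m
    change ContDiffOn ℝ ∞ (fun p => ∑ m, ∑ n, frame S q p J m * frame S q p K n *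
      extD (tetrad S q i) p (vec m) (vec n)) U
    exact ContDiffOn.sum fun m _ => ContDiffOn.sum fun n _ => ((hf J m).mul (hf K n)).mul
      (contDiffOn_extD hU (contDiffOn_tetrad hU hS hineq hq i) _ _)
  skew p _ i J K := structureCoeff_skew S q i J K p
  expand p hp i u v := by
    have h : ∀ u v, extD (tetrad S q i) p u v = ∑ J, ∑ K, structureCoeff S q i J K p *
        (coframe S q J p u * coframe S q K p v) :=
      expand_bilinear (cev_frame_coframe S q hq hp) (fun _ => extD_linear_left _ _ _)
        (fun _ => extD_linear_right _ _ _)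
    -- The bilinear expansion has tensor products `θ^J ⊗ θ^K`; antisymmetrizing in `u, v` turns them
    -- into wedges and produces the factor `1/2`.
    have h2 : extD (tetrad S q i) p u v =
        (1 / 2) * (extD (tetrad S q i) p u v - extD (tetrad S q i) p v u) := by
      rw [extD_swap _ p v u]; ring
    rw [h2, h u v, h v u, ← Finset.sum_sub_distrib]
    simp only [← Finset.sum_sub_distrib, wedge, mul_sub]

/-! ### Torsion-free Weyl connections in components -/

theorem fin_six_cases {P : Fin 6 → Prop} (h : ∀ i : Fin 4, P (up i)) (h4 : P 4) (h5 : P 5)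
    (K : Fin 6) : P K := by
  fin_cases K
  · exact h 0
  · exact h 1
  · exact h 2
  · exact h 3
  · exact h4
  · exact h5

theorem η_symm (i j : Fin 4) : η i j = η j i := by
  fin_cases i <;> fin_cases j <;> rfl

theorem sum_η_sum_η (x : Fin 4 → ℂ) (i : Fin 4) : ∑ l, η i l * ∑ k, η l k * x k = x i := by
  have h : Matrix.mulVec η (Matrix.mulVec η x) = x := by
    rw [Matrix.mulVec_mulVec, η_mul_η, Matrix.one_mulVec]
  exact congrFun h i

theorem sum_η_eq_zero_iff (x : Fin 4 → ℂ) : (∀ i, ∑ l, η i l * x l = 0) ↔ ∀ i, x i = 0 := by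
  refine ⟨fun h i => ?_, fun h i => by simp [h]⟩
  rw [← sum_η_sum_η x i]
  simp [h]

/-- The component form of the equations of a torsion-free Weyl connection; `Δ` are the structure
coefficients with lowered first index. -/
structure IsWeylSystem (Δ : Fin 4 → Fin 6 → Fin 6 → ℂ) (g : Fin 4 → Fin 4 → Fin 6 → ℂ)
    (A : Fin 6 → ℂ) : Prop where
  torsion : ∀ i l m, Δ i (up l) (up m) + g i m (up l) - g i l (up m) = 0
  torsion_s : ∀ i m, g i m 4 = Δ i (up m) 4
  torsion_sc : ∀ i m, g i m 5 = Δ i (up m) 5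
  fiber : ∀ i, Δ i 4 5 = 0
  weyl : ∀ i j K, g i j K + g j i K = 2 * η i j * A K

/-- Only the symmetric part contributes to the trace, and `η` has trace `4` with respect to itself.
-/
theorem trace_eq {d : Fin 4 → Fin 4 → ℂ} {a : ℂ} (h : ∀ i j, d i j + d j i = 2 * η i j * a) :
    (1 / 4) * ∑ k, ∑ l, η k l * d l k = a := by
  have h1 := h 0 1
  have h2 := h 2 3
  simp [η] at h1 h2
  simp [Fin.sum_univ_four, η]
  linear_combination (1 / 4) * h1 - (1 / 4) * h2

/-- As for Levi-Civita, three cyclic torsion equations and three symmetry equations isolate `g i j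
k`. In the converse, the given solution `g', A'` serves only to supply the conditions on `Δ` alone.
These do not see the space-time components of `A`, so any choice of them is allowed. -/
theorem isWeylSystem_iff {Δ : Fin 4 → Fin 6 → Fin 6 → ℂ} (hΔ : ∀ i J K, Δ i J K = -Δ i K J)
    (hex : ∃ g A, IsWeylSystem Δ g A) (g : Fin 4 → Fin 4 → Fin 6 → ℂ) (A : Fin 6 → ℂ) :
    IsWeylSystem Δ g A ↔
      (∀ i j, (∀ k, g i j (up k) = η i j * A (up k) - η j k * A (up i) + η k i * A (up j)
        + (1 / 2) * (Δ i (up j) (up k) - Δ k (up i) (up j) + Δ j (up k) (up i))) ∧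
        g i j 4 = Δ i (up j) 4 ∧ g i j 5 = Δ i (up j) 5) ∧
      A 4 = (1 / 4) * ∑ k, ∑ l, η k l * Δ l (up k) 4 ∧
      A 5 = (1 / 4) * ∑ k, ∑ l, η k l * Δ l (up k) 5 := by
  constructor
  · intro h
    refine ⟨fun i j => ⟨fun k => ?_, h.torsion_s i j, h.torsion_sc i j⟩, ?_, ?_⟩
    · have e1 := h.torsion i j k
      have e2 := h.torsion k i j
      have e3 := h.torsion j k i
      have w1 := h.weyl i j (up k)
      have w2 := h.weyl i k (up j)
      have w3 := h.weyl j k (up i)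
      rw [η_symm k i]
      linear_combination (-1 / 2) * e1 + (1 / 2) * e2 - (1 / 2) * e3 + (1 / 2) * w1
        + (1 / 2) * w2 - (1 / 2) * w3
    · refine (trace_eq fun i j => ?_).symm
      rw [← h.torsion_s, ← h.torsion_s]
      exact h.weyl i j 4
    · refine (trace_eq fun i j => ?_).symm
      rw [← h.torsion_sc, ← h.torsion_sc]
      exact h.weyl i j 5
  · rintro ⟨h, h4, h5⟩
    obtain ⟨g', A', h'⟩ := hex
    have t4 : ∀ i j, Δ i (up j) 4 + Δ j (up i) 4 = 2 * η i j * A' 4 := fun i j => by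
      rw [← h'.torsion_s, ← h'.torsion_s]
      exact h'.weyl i j 4
    have t5 : ∀ i j, Δ i (up j) 5 + Δ j (up i) 5 = 2 * η i j * A' 5 := fun i j => by
      rw [← h'.torsion_sc, ← h'.torsion_sc]
      exact h'.weyl i j 5
    refine ⟨fun i l m => ?_, fun i m => (h i m).2.1, fun i m => (h i m).2.2, h'.fiber,
      fun i j K => ?_⟩
    · rw [(h i m).1 l, (h i l).1 m, η_symm l i, η_symm m i, η_symm m l]
      linear_combination (1 / 2) * hΔ i (up m) (up l) + (1 / 2) * hΔ m (up l) (up i)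
        - (1 / 2) * hΔ l (up i) (up m)
    · refine fin_six_cases (P := fun K => g i j K + g j i K = 2 * η i j * A K) (fun k => ?_) ?_ ?_ K
      · rw [(h i j).1 k, (h j i).1 k, η_symm k i, η_symm k j, η_symm j i]
        linear_combination (1 / 2) * hΔ i (up j) (up k) - (1 / 2) * hΔ k (up i) (up j)
          + (1 / 2) * hΔ j (up k) (up i)
      · rw [(h i j).2.1, (h j i).2.1, t4, h4, trace_eq t4]
      · rw [(h i j).2.2, (h j i).2.2, t5, h5, trace_eq t5]

/-! ### Passage between equations of forms and equations of components in the coframe. -/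

section components
variable {U : Set J6} {S : J6 → ℂ} {q : TetradParams} {p : J6}

theorem up_injective : Function.Injective up := Fin.castLE_injective (by norm_num)

theorem up_ne_four (i : Fin 4) : up i ≠ 4 := by fin_cases i <;> decide

theorem up_ne_five (i : Fin 4) : up i ≠ 5 := by fin_cases i <;> decide

theorem torsion_expr_isLinear (θ : OneForm) (ψ φ : Fin 4 → J6 →L[ℝ] ℂ) :
    (∀ v, IsLinearMap ℝ fun u => extD θ p u v + ∑ j, wedge (ψ j) (φ j) u v) ∧
      ∀ u, IsLinearMap ℝ fun v => extD θ p u v + ∑ j, wedge (ψ j) (φ j) u v := by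
  refine ⟨fun v => ⟨fun x y => ?_, fun k x => ?_⟩, fun u => ⟨fun x y => ?_, fun k x => ?_⟩⟩
  · simp only [(extD_linear_left θ p v).map_add, (wedge_linear_left _ _ v).map_add,
      Finset.sum_add_distrib]
    ring
  · simp only [(extD_linear_left θ p v).map_smul, (wedge_linear_left _ _ v).map_smul,
      Finset.smul_sum, smul_add]
  · simp only [(extD_linear_right θ p u).map_add, (wedge_linear_right _ _ u).map_add,
      Finset.sum_add_distrib]
    ring
  · simp only [(extD_linear_right θ p u).map_smul, (wedge_linear_right _ _ u).map_smul,
      Finset.smul_sum, smul_add]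

theorem cev_frame_tetrad (hq : q.IsAdmissible U) (hp : p ∈ U) (J : Fin 6) (k : Fin 4) :
    cev (frame S q p J) (tetrad S q k p) = if J = up k then 1 else 0 := by
  rw [← cev_frame_coframe S q hq hp, coframe_up]

theorem cev2_torsion (E E' : Fin 6 → ℂ) (i : Fin 4) (Γ : Fin 4 → Fin 4 → OneForm) :
    cev2 E E' (fun u v => extD (tetrad S q i) p u v
      + ∑ j, wedge (∑ k, η i k • Γ k j p) (tetrad S q j p) u v) =
    cev2 E E' (extD (tetrad S q i) p) + ∑ k, η i k * ∑ j, (cev E (Γ k j p) *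
      cev E' (tetrad S q j p) - cev E' (Γ k j p) * cev E (tetrad S q j p)) := by
  rw [cev2_add, cev2_sum]
  simp only [cev2_wedge, cev_clm_sum, cev_clm_smul, Finset.mul_sum, Finset.sum_mul]
  rw [Finset.sum_comm (f := fun k j => η i k * _)]
  simp only [← Finset.sum_sub_distrib]
  congr 1
  exact Finset.sum_congr rfl fun j _ => Finset.sum_congr rfl fun k _ => by ring

theorem torsion_free_iff (hq : q.IsAdmissible U) (hp : p ∈ U) (Γ : Fin 4 → Fin 4 → OneForm) :
    (∀ i u v, extD (tetrad S q i) p u v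
      + ∑ j, wedge (∑ k, η i k • Γ k j p) (tetrad S q j p) u v = 0) ↔
    ∀ i L M, lowerΔ (structureCoeff S q) i L M p + ∑ j,
      ((cev (frame S q p L) (Γ i j p) * if M = up j then 1 else 0)
        - cev (frame S q p M) (Γ i j p) * if L = up j then 1 else 0) = 0 := by
  have key : ∀ i L M, cev2 (frame S q p L) (frame S q p M) (fun u v => extD (tetrad S q i) p u v
      + ∑ j, wedge (∑ k, η i k • Γ k j p) (tetrad S q j p) u v) =
      ∑ k, η i k * (lowerΔ (structureCoeff S q) k L M p + ∑ j,
      ((cev (frame S q p L) (Γ k j p) * if M = up j then 1 else 0)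
        - cev (frame S q p M) (Γ k j p) * if L = up j then 1 else 0)) := by
    intro i L M
    rw [cev2_torsion]
    simp only [mul_add, Finset.sum_add_distrib, lowerΔ,
      sum_η_sum_η (fun l => structureCoeff S q l L M p), cev_frame_tetrad hq hp]
    rfl
  have hz : ∀ (i : Fin 4) (L M : Fin 6), cev2 (frame S q p L) (frame S q p M)
      (fun _ _ => 0) = 0 := by simp [cev2]
  constructor
  · intro h i L M
    refine (sum_η_eq_zero_iff fun i => lowerΔ (structureCoeff S q) i L M p + ∑ j,
      ((cev (frame S q p L) (Γ i j p) * if M = up j then 1 else 0)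
        - cev (frame S q p M) (Γ i j p) * if L = up j then 1 else 0)).1 (fun i => ?_) i
    rw [← key]
    simp only [h]
    exact hz i L M
  · intro h i u v
    obtain ⟨hl, hr⟩ := torsion_expr_isLinear (p := p) (tetrad S q i)
      (fun j => ∑ k, η i k • Γ k j p) fun j => tetrad S q j p
    rw [expand_bilinear (cev_frame_coframe S q hq hp) hl hr u v]
    simp only [key, h]
    simp

/-- At a point, the equations of a torsion-free Weyl connection are equations between components
in the coframe. -/
theorem weyl_iff (hq : q.IsAdmissible U) (hp : p ∈ U) (Γ : Fin 4 → Fin 4 → OneForm) (A : OneForm) :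
    ((∀ i u v, extD (tetrad S q i) p u v
      + ∑ j, wedge (∑ k, η i k • Γ k j p) (tetrad S q j p) u v = 0) ∧
      ∀ i j, (1 / 2 : ℂ) • (Γ i j p + Γ j i p) = η i j • A p) ↔
    IsWeylSystem (fun i J K => lowerΔ (structureCoeff S q) i J K p)
      (fun i j K => cev (frame S q p K) (Γ i j p)) (fun K => cev (frame S q p K) (A p)) := by
  have hskew := fun i J K => lowerΔ_structureCoeff_skew S q i J K p
  rw [torsion_free_iff hq hp]
  constructor
  · rintro ⟨h, hw⟩
    refine ⟨fun i l m => ?_, fun i m => ?_, fun i m => ?_, fun i => ?_, fun i j K => ?_⟩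
    · have := h i (up l) (up m)
      simp [Finset.sum_sub_distrib, up_injective.eq_iff] at this
      linear_combination this
    · have := h i (up m) 4
      simp [up_injective.eq_iff, (up_ne_four _).symm] at this
      linear_combination -this
    · have := h i (up m) 5
      simp [up_injective.eq_iff, (up_ne_five _).symm] at this
      linear_combination -this
    · have := h i 4 5
      simpa [(up_ne_four _).symm, (up_ne_five _).symm] using this
    · have := congrArg (fun φ : J6 →L[ℝ] ℂ => cev (frame S q p K) φ) (hw i j)
      simp only [cev_clm_smul, cev_clm_add] at this
      linear_combination 2 * this
  · intro h
    constructor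
    · intro i
      have h4 : ∀ m, lowerΔ (structureCoeff S q) i (up m) 4 p + ∑ j,
          ((cev (frame S q p (up m)) (Γ i j p) * if 4 = up j then 1 else 0)
          - cev (frame S q p 4) (Γ i j p) * if up m = up j then 1 else 0) = 0 := by
        intro m
        have := h.torsion_s i m
        simp [up_injective.eq_iff, (up_ne_four _).symm]
        linear_combination -this
      have h5 : ∀ m, lowerΔ (structureCoeff S q) i (up m) 5 p + ∑ j,
          ((cev (frame S q p (up m)) (Γ i j p) * if 5 = up j then 1 else 0)
          - cev (frame S q p 5) (Γ i j p) * if up m = up j then 1 else 0) = 0 := by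
        intro m
        have := h.torsion_sc i m
        simp [up_injective.eq_iff, (up_ne_five _).symm]
        linear_combination -this
      have hsw : ∀ L M, lowerΔ (structureCoeff S q) i L M p + ∑ j,
          ((cev (frame S q p L) (Γ i j p) * if M = up j then 1 else 0)
          - cev (frame S q p M) (Γ i j p) * if L = up j then 1 else 0) = 0 →
          lowerΔ (structureCoeff S q) i M L p + ∑ j,
          ((cev (frame S q p M) (Γ i j p) * if L = up j then 1 else 0)
          - cev (frame S q p L) (Γ i j p) * if M = up j then 1 else 0) = 0 := by
        intro L M h
        rw [Finset.sum_sub_distrib] at h ⊢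
        linear_combination -h + hskew i L M
      have h45 := h.fiber i
      have h44 := hskew i 4 4
      have h55 := hskew i 5 5
      refine fin_six_cases (fun l => fin_six_cases (fun m => ?_) (h4 l) (h5 l))
        (fin_six_cases (fun m => hsw _ _ (h4 m)) ?_ ?_)
        (fin_six_cases (fun m => hsw _ _ (h5 m)) (hsw _ _ ?_) ?_)
      · have := h.torsion i l m
        simp [Finset.sum_sub_distrib, up_injective.eq_iff]
        linear_combination this
      · simp
        linear_combination (1 / 2) * h44
      · simpa [(up_ne_four _).symm, (up_ne_five _).symm] using h45
      · simpa [(up_ne_four _).symm, (up_ne_five _).symm] using h45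
      · simp
        linear_combination (1 / 2) * h55
    · intro i j
      rw [expand_clm (cev_frame_coframe S q hq hp) ((1 / 2 : ℂ) • (Γ i j p + Γ j i p)),
        expand_clm (cev_frame_coframe S q hq hp) (η i j • A p)]
      refine Finset.sum_congr rfl fun K _ => ?_
      congr 1
      have := h.weyl i j K
      simp only [cev_clm_smul, cev_clm_add]
      linear_combination (1 / 2) * this

theorem cev_frame_expansion (hq : q.IsAdmissible U) (hp : p ∈ U) (x : Fin 4 → ℂ) (y z : ℂ) :
    (∀ k, cev (frame S q p (up k))
        (∑ i, x i • tetrad S q i p + y • ds + z • dsc : J6 →L[ℝ] ℂ) = x k) ∧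
      cev (frame S q p 4) (∑ i, x i • tetrad S q i p + y • ds + z • dsc : J6 →L[ℝ] ℂ) = y ∧
      cev (frame S q p 5) (∑ i, x i • tetrad S q i p + y • ds + z • dsc : J6 →L[ℝ] ℂ) = z := by
  have h4 : ∀ J, cev (frame S q p J) ds = if J = 4 then 1 else 0 := fun J =>
    cev_frame_coframe S q hq hp J 4
  have h5 : ∀ J, cev (frame S q p J) dsc = if J = 5 then 1 else 0 := fun J =>
    cev_frame_coframe S q hq hp J 5
  simp only [cev_clm_add, cev_clm_sum, cev_clm_smul, h4, h5, cev_frame_tetrad hq hp]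
  refine ⟨fun k => ?_, ?_, ?_⟩
  · simp [up_injective.eq_iff, up_ne_four, up_ne_five]
  · simp [(up_ne_four _).symm]
  · simp [(up_ne_five _).symm]

theorem eq_expansion_iff (hq : q.IsAdmissible U) (hp : p ∈ U) (φ : J6 →L[ℝ] ℂ) (x : Fin 4 → ℂ)
    (y z : ℂ) : φ = ∑ i, x i • tetrad S q i p + y • ds + z • dsc ↔
      (∀ k, cev (frame S q p (up k)) φ = x k) ∧ cev (frame S q p 4) φ = y ∧
        cev (frame S q p 5) φ = z := by
  obtain ⟨h1, h2, h3⟩ := cev_frame_expansion (S := S) hq hp x y z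
  constructor
  · rintro rfl
    exact ⟨h1, h2, h3⟩
  · rintro ⟨g1, g2, g3⟩
    rw [expand_clm (cev_frame_coframe S q hq hp) φ,
      expand_clm (cev_frame_coframe S q hq hp) (∑ i, x i • tetrad S q i p + y • ds + z • dsc)]
    refine Finset.sum_congr rfl fun K _ => ?_
    congr 1
    refine fin_six_cases (P := fun K => cev (frame S q p K) φ = cev (frame S q p K)
      (∑ i, x i • tetrad S q i p + y • ds + z • dsc : J6 →L[ℝ] ℂ)) (fun k => ?_) ?_ ?_ K
    · rw [g1, h1]
    · rw [g2, h2]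
    · rw [g3, h3]

end components

/-- Neither `Γ` nor `A` is differentiated in the defining equations, so the equivalence can be
proved point by point as linear algebra in the components. -/
theorem weyl_connection_unique {U : Set J6} {S : J6 → ℂ} {q : TetradParams}
    (hq : q.IsAdmissible U) (htf : ∃ (Γ : Fin 4 → Fin 4 → OneForm) (A : OneForm),
      IsTorsionFreeWeyl U (tetrad S q) Γ A) (A4 : Fin 4 → J6 → ℂ)
    (Γ : Fin 4 → Fin 4 → OneForm) (A : OneForm) :
    (IsTorsionFreeWeyl U (tetrad S q) Γ A ∧ HasSpacetimePart U S q A A4) ↔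
      ∀ p ∈ U, (∀ i j, Γ i j p = connForm S q (structureCoeff S q) A4 i j p) ∧
        A p = weylForm S q (structureCoeff S q) A4 p := by
  have htr : ∀ p J, ∑ k, ∑ l, η k l * lowerΔ (structureCoeff S q) l (up k) J p =
      ∑ k, structureCoeff S q k (up k) J p := fun p J =>
    Finset.sum_congr rfl fun k _ => sum_η_sum_η (fun l => structureCoeff S q l (up k) J p) k
  have hpt : ∀ p ∈ U, (IsWeylSystem (fun i J K => lowerΔ (structureCoeff S q) i J K p)
      (fun i j K => cev (frame S q p K) (Γ i j p)) (fun K => cev (frame S q p K) (A p)) ∧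
        ∀ k, cev (frame S q p (up k)) (A p) = A4 k p) ↔
      (∀ i j, Γ i j p = connForm S q (structureCoeff S q) A4 i j p) ∧
        A p = weylForm S q (structureCoeff S q) A4 p := by
    intro p hp
    obtain ⟨Γ', A', h'⟩ := htf
    have hex := (weyl_iff hq hp Γ' A').1 ⟨h'.torsion_free p hp, h'.weyl p hp⟩
    rw [isWeylSystem_iff (fun i J K => lowerΔ_structureCoeff_skew S q i J K p)
      ⟨_, _, hex⟩]
    simp only [connForm, weylForm, eq_expansion_iff hq hp, htr, connCoeff]
    constructor
    · rintro ⟨⟨h1, h2, h3⟩, h4⟩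
      simp only [h4] at h1
      exact ⟨h1, h4, h2, h3⟩
    · rintro ⟨h1, h4, h2, h3⟩
      refine ⟨⟨?_, h2, h3⟩, h4⟩
      simpa only [h4] using h1
  constructor
  · rintro ⟨h, hA⟩ p hp
    refine (hpt p hp).1 ⟨(weyl_iff hq hp Γ A).1 ⟨h.torsion_free p hp, h.weyl p hp⟩, ?_⟩
    obtain ⟨x, y, hxy⟩ := hA p hp
    exact ((eq_expansion_iff hq hp (A p) (fun i => A4 i p) x y).1 hxy).1
  · intro h
    have h1 := fun p hp => (hpt p hp).2 (h p hp)
    refine ⟨⟨fun p hp => ((weyl_iff hq hp Γ A).2 (h1 p hp).1).1,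
      fun p hp => ((weyl_iff hq hp Γ A).2 (h1 p hp).1).2⟩, fun p hp => ⟨_, _, (h p hp).2⟩⟩

/-! ### Algebra of the fiber equations -/

section algebra
variable {b B x y X Y w v W V a a' A E l : ℂ}

/-- Elimination of the conformal factor from the fiber equations along `D`. Here `B`, `a'` stand for
the conjugates of `b`, `a`; `x`, `y` for `D b`, `D b*`; `w`, `v` for `S_W`, `S_{W*}`; `A`, `E` for
`α²` and its derivative. -/
theorem fiber_elimination (h0 : A * (1 - b * B) ^ 2 = 1 + b * B)
    (hE : E * (1 - b * B) ^ 2 - 2 * A * (1 - b * B) * (B * x + b * y) = B * x + b * y)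
    (h2 : a - A * (2 * B * w + y) - E * B + l * A * B = 0)
    (h3 : A * ((1 + b * B) * v + x) + E * b - l * A * b = 0)
    (h4 : a' - A * (2 * B * v + (1 + b * B) * w + (B * x + b * y)) - E * (1 + b * B)
      + l * A * (1 + b * B) = 0)
    (hm : 1 - b * B ≠ 0) :
    b * a' * (1 - b * B) ^ 2 =
      (1 + b * B) * (b ^ 2 * y - x + (1 + b * B) * b * w - (1 + (b * B) ^ 2) * v) ∧
    (a * (1 + b * B) - a' * B) * (1 - b * B) ^ 2 =
      (1 + b * B) * (y - B ^ 2 * x + (1 + b * B) * B * w - 2 * B ^ 2 * v) ∧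
    a' * (1 - b * B) ^ 3 - 4 * (1 + b * B) * (B * x + b * y)
      + (1 + b * B) ^ 2 * (1 - b * B) * (l - w) - 2 * (1 + b * B) * (1 - b * B) * B * v = 0 := by
  -- `E` and `l` enter `h2`, `h3`, `h4` only through `E - l * A`, so eliminating `l` removes `E`
  -- too. The value of `E` matters only for the last relation, which keeps `l` for the later
  -- computation of `c`.
  have hE' : E * (1 - b * B) ^ 3 = (B * x + b * y) * (3 + b * B) := by
    linear_combination (1 - b * B) * hE + 2 * (B * x + b * y) * h0
  have e2 : a * (1 - b * B) ^ 3 - (1 + b * B) * (1 - b * B) * (2 * B * w + y)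
      - (B * x + b * y) * (3 + b * B) * B + l * (1 + b * B) * (1 - b * B) * B = 0 := by
    linear_combination (1 - b * B) ^ 3 * h2 + (1 - b * B) * (2 * B * w + y - l * B) * h0 + B * hE'
  have e3 : (1 + b * B) * (1 - b * B) * ((1 + b * B) * v + x)
      + (B * x + b * y) * (3 + b * B) * b - l * (1 + b * B) * (1 - b * B) * b = 0 := by
    linear_combination (1 - b * B) ^ 3 * h3 - (1 - b * B) * ((1 + b * B) * v + x - l * b) * h0
      - b * hE'
  have e4 : a' * (1 - b * B) ^ 3
      - (1 + b * B) * (1 - b * B) * (2 * B * v + (1 + b * B) * w + (B * x + b * y))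
      - (B * x + b * y) * (3 + b * B) * (1 + b * B)
      + l * (1 + b * B) * (1 - b * B) * (1 + b * B) = 0 := by
    linear_combination (1 - b * B) ^ 3 * h4 + (1 - b * B) * (2 * B * v + (1 + b * B) * w
      + (B * x + b * y) - l * (1 + b * B)) * h0 + (1 + b * B) * hE'
  refine ⟨mul_left_cancel₀ hm ?_, mul_left_cancel₀ hm ?_, ?_⟩
  · linear_combination b * e4 + (1 + b * B) * e3
  · linear_combination (1 + b * B) * e2 - B * e4
  · linear_combination e4

/-- The consequences of the equations of `fiber_elimination` and of their conjugates; `W`, `V`, `X`,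
`Y` stand for the conjugates of `w`, `v`, `x`, `y`. -/
theorem fiber_solution (hm : 1 - b * B ≠ 0) (hp : 1 + b * B ≠ 0)
    (hc : 1 + b * B + (b * B) ^ 2 ≠ 0)
    (h1 : b * a' * (1 - b * B) ^ 2 =
      (1 + b * B) * (b ^ 2 * y - x + (1 + b * B) * b * w - (1 + (b * B) ^ 2) * v))
    (h2 : (a * (1 + b * B) - a' * B) * (1 - b * B) ^ 2 =
      (1 + b * B) * (y - B ^ 2 * x + (1 + b * B) * B * w - 2 * B ^ 2 * v))
    (h1' : B * a * (1 - b * B) ^ 2 =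
      (1 + b * B) * (B ^ 2 * Y - X + (1 + b * B) * B * W - (1 + (b * B) ^ 2) * V))
    (h2' : (a' * (1 + b * B) - a * b) * (1 - b * B) ^ 2 =
      (1 + b * B) * (Y - b ^ 2 * X + (1 + b * B) * b * W - 2 * b ^ 2 * V)) :
    x + b * Y + v - b * w + b ^ 2 * W - b ^ 3 * V = 0 ∧
    X + B * y + V - B * W + B ^ 2 * w - B ^ 3 * v = 0 ∧
    a * (1 - b * B) ^ 3 =
      (1 + b * B) * (B ^ 2 * x + y + (B * Y + b * X) + (1 - b * B) * (B * w + b * V)) ∧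
    a * (b * B) * (1 - b * B) ^ 2 =
      (1 + b * B) * (B ^ 2 * (-x + b * w - v) + b * (-X + B * W - V)) ∧
    (B * x + b * y) * (1 - b * B) * (1 + b * B) =
      ((1 + b * B) * (b * a) - 2 * (b * B) * a') * (1 - b * B) ^ 2
        - (1 - b * B) ^ 2 * (1 + b * B) * (B * v) := by
  -- Rescaling `a` and `a'` lets the common factor `1 + b * B` be cancelled from all four relations.
  obtain ⟨t, ht⟩ : ∃ t, a * (1 - b * B) ^ 2 = (1 + b * B) * t :=
    ⟨a * (1 - b * B) ^ 2 / (1 + b * B), by field_simp⟩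
  obtain ⟨t', ht'⟩ : ∃ t, a' * (1 - b * B) ^ 2 = (1 + b * B) * t :=
    ⟨a' * (1 - b * B) ^ 2 / (1 + b * B), by field_simp⟩
  have g1 : b * t' = b ^ 2 * y - x + (1 + b * B) * b * w - (1 + (b * B) ^ 2) * v :=
    mul_left_cancel₀ hp (by linear_combination h1 - b * ht')
  have g2 : (1 + b * B) * t - B * t' =
      y - B ^ 2 * x + (1 + b * B) * B * w - 2 * B ^ 2 * v :=
    mul_left_cancel₀ hp (by linear_combination h2 - (1 + b * B) * ht + B * ht')
  have g1' : B * t = B ^ 2 * Y - X + (1 + b * B) * B * W - (1 + (b * B) ^ 2) * V :=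
    mul_left_cancel₀ hp (by linear_combination h1' - B * ht)
  have g2' : (1 + b * B) * t' - b * t =
      Y - b ^ 2 * X + (1 + b * B) * b * W - 2 * b ^ 2 * V :=
    mul_left_cancel₀ hp (by linear_combination h2' - (1 + b * B) * ht' + b * ht)
  -- `t'` drops out of `b * g2 + B * g1`. Together with the conjugate relations there are now more
  -- equations than unknowns, and comparing them gives `m1` and `m2`.
  have g3 : b * t = b * y - B * x + 2 * (b * B) * w - (1 + b * B) * B * v :=
    mul_left_cancel₀ hp (by linear_combination b * g2 + B * g1)
  have g3' : B * t' = B * Y - b * X + 2 * (b * B) * W - (1 + b * B) * b * V :=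
    mul_left_cancel₀ hp (by linear_combination B * g2' + b * g1')
  have m1 : x + b * Y + v - b * w + b ^ 2 * W - b ^ 3 * V =
      b ^ 3 * (X + B * y + V - B * W + B ^ 2 * w - B ^ 3 * v) := by
    linear_combination (1 + b * B) * g1 - b * g2' - b * g3
  have m2 : X + B * y + V - B * W + B ^ 2 * w - B ^ 3 * v =
      B ^ 3 * (x + b * Y + v - b * w + b ^ 2 * W - b ^ 3 * V) := by
    linear_combination (1 + b * B) * g1' - B * g2 - B * g3'
  -- `m1` and `m2` read `N = b³N*` and `N* = B³N` for the numerator `N` of the invariant. Hence `(1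
  -- - (bB)³) N = 0`, and `1 - (bB)³` is the product of the two nonzero factors used here.
  have hM : x + b * Y + v - b * w + b ^ 2 * W - b ^ 3 * V = 0 := by
    refine mul_left_cancel₀ (mul_ne_zero hm hc) ?_
    linear_combination m1 + b ^ 3 * m2
  have hM' : X + B * y + V - B * W + B ^ 2 * w - B ^ 3 * v = 0 := by
    rw [m2, hM, mul_zero]
  refine ⟨hM, hM', ?_, ?_, ?_⟩
  · linear_combination (1 - b * B) * ht + (1 + b * B) * (g2 + g3' - 2 * B * g3 - 2 * b * hM')
  · linear_combination (b * B) * ht + (1 + b * B) * (B * g3 + b * hM')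
  · have k : (B * x + b * y) * (1 - b * B) =
        (1 + b * B) * (b * t) - 2 * (b * B) * t' - (1 - b * B) ^ 2 * (B * v) := by
      linear_combination (-1 - b * B) * g3 + 2 * B * g1
    linear_combination (1 + b * B) * k - (1 + b * B) * b * ht + 2 * (b * B) * ht'

end algebra

/-! ### Lie derivatives of the tetrad along `D` -/

section lie
variable {S : J6 → ℂ} {p : J6}

theorem D_mul {f g : J6 → ℂ} (hf : DifferentiableAt ℝ f p) (hg : DifferentiableAt ℝ g p) :
    D S (fun x => f x * g x) p = f p * D S g p + D S f p * g p := by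
  simp only [← cev_vecD]
  rw [fderiv_fun_mul hf hg, cev_clm_add, cev_clm_smul, cev_clm_smul]
  ring

theorem Dc_mul {f g : J6 → ℂ} (hf : DifferentiableAt ℝ f p) (hg : DifferentiableAt ℝ g p) :
    Dc S (fun x => f x * g x) p = f p * Dc S g p + Dc S f p * g p := by
  simp only [← cev_vecDc]
  rw [fderiv_fun_mul hf hg, cev_clm_add, cev_clm_smul, cev_clm_smul]
  ring

theorem D_add {f g : J6 → ℂ} (hf : DifferentiableAt ℝ f p) (hg : DifferentiableAt ℝ g p) :
    D S (fun x => f x + g x) p = D S f p + D S g p := by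
  simp only [← cev_vecD]
  rw [fderiv_fun_add hf hg, cev_clm_add]

theorem D_const (k : ℂ) : D S (fun _ => k) p = 0 := by
  rw [← cev_vecD]
  simp [cev]

theorem Dc_const (k : ℂ) : Dc S (fun _ => k) p = 0 := by
  rw [← cev_vecDc]
  simp [cev]

theorem D_congr {f g : J6 → ℂ} (h : f =ᶠ[nhds p] g) : D S f p = D S g p := by
  simp only [← cev_vecD, h.fderiv_eq]

theorem Dc_congr {f g : J6 → ℂ} (h : f =ᶠ[nhds p] g) : Dc S f p = Dc S g p := by
  simp only [← cev_vecDc, h.fderiv_eq]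

theorem extD_smul {f : J6 → ℂ} {θ : OneForm} (hf : DifferentiableAt ℝ f p)
    (hθ : DifferentiableAt ℝ θ p) : extD (fun x => f x • θ x) p =
      fun u v => f p * extD θ p u v + wedge (fderiv ℝ f p) (θ p) u v := by
  ext u v
  simp only [extD, wedge]
  rw [fderiv_fun_smul hf hθ]
  simp
  ring

theorem extD_add {θ ψ : OneForm} (hθ : DifferentiableAt ℝ θ p) (hψ : DifferentiableAt ℝ ψ p) :
    extD (fun x => θ x + ψ x) p = fun u v => extD θ p u v + extD ψ p u v := by
  ext u v
  simp only [extD]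
  rw [fderiv_fun_add hθ hψ]
  simp
  ring

theorem extD_β {f g : J6 → ℂ} (φ : J6 →L[ℝ] ℂ) (hf : DifferentiableAt ℝ f p)
    (hg : DifferentiableAt ℝ g p) : extD (fun x => φ - f x • ds - g x • dsc) p =
      fun u v => -1 * wedge (fderiv ℝ f p) ds u v + -1 * wedge (fderiv ℝ g p) dsc u v := by
  ext u v
  simp only [extD, wedge]
  have h1 : DifferentiableAt ℝ (fun x => f x • ds) p := hf.smul_const ds
  have h2 : DifferentiableAt ℝ (fun x => g x • dsc) p := hg.smul_const dsc
  rw [fderiv_fun_sub (h1.const_sub φ) h2, fderiv_const_sub, 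
    fderiv_fun_smul hf (differentiableAt_const ds),
    fderiv_fun_smul hg (differentiableAt_const dsc)]
  simp
  ring

variable (S p) in
/-- The Lie derivative of a one-form along `D`, on the vertical vector with components
`z`, `r`, `w`, `w'`; it is meant for one-forms which vanish on `D`. -/
noncomputable def lieD (z r w w' : ℂ) (θ : OneForm) : ℂ :=
  cev2 (vecD S p) (coordVec z r w w' 0 0) (extD θ p)

variable {z r w w' : ℂ}

theorem lieD_smul {f : J6 → ℂ} {θ : OneForm} (hf : DifferentiableAt ℝ f p)
    (hθ : DifferentiableAt ℝ θ p) (h0 : cev (vecD S p) (θ p) = 0) :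
    lieD S p z r w w' (fun x => f x • θ x) =
      f p * lieD S p z r w w' θ + D S f p * cev (coordVec z r w w' 0 0) (θ p) := by
  rw [lieD, extD_smul hf hθ, cev2_add, cev2_const_mul, cev2_wedge, h0, cev_vecD, lieD]
  ring

theorem lieD_add {θ ψ : OneForm} (hθ : DifferentiableAt ℝ θ p) (hψ : DifferentiableAt ℝ ψ p) :
    lieD S p z r w w' (fun x => θ x + ψ x) = lieD S p z r w w' θ + lieD S p z r w w' ψ := by
  rw [lieD, extD_add hθ hψ, cev2_add]
  rfl

/-- In `-df ∧ ds - dg ∧ ds*` evaluated on `D` and a vertical vector, only `ds(D) = 1` survives, so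
the result is the vertical derivative of `f`. -/
theorem lieD_β {f g : J6 → ℂ} (φ : J6 →L[ℝ] ℂ) (hf : DifferentiableAt ℝ f p)
    (hg : DifferentiableAt ℝ g p) : lieD S p z r w w' (fun x => φ - f x • ds - g x • dsc) =
      cev (coordVec z r w w' 0 0) (fderiv ℝ f p) := by
  rw [lieD, extD_β φ hf hg, cev2_add, cev2_const_mul, cev2_const_mul, cev2_wedge, cev2_wedge, vecD,
    cev_ds, cev_ds, cev_dsc, cev_dsc]
  ring

theorem lieD_β0 : lieD S p z r w w' β0 = w := by
  refine (lieD_β dZ dW.differentiableAt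
    (dWc.differentiableAt : DifferentiableAt ℝ (fun x => conj (cW x)) p)).trans ?_
  rw [dW.fderiv, cev_dW]

theorem lieD_βm (hSc : DifferentiableAt ℝ (cc S) p) : lieD S p z r w w' (βm S) = r := by
  refine (lieD_β dWc (dR.differentiableAt : DifferentiableAt ℝ cR p) hSc).trans ?_
  rw [dR.fderiv, cev_dR]

theorem lieD_βp (hS : DifferentiableAt ℝ S p) : lieD S p z r w w' (βp S) =
    z * pdZ S p + r * pdR S p + w * pdW S p + w' * pdWc S p := by
  refine (lieD_β dW hS (dR.differentiableAt : DifferentiableAt ℝ cR p)).trans ?_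
  rw [cev_coordVec_fderiv]
  ring

theorem lieD_β1 (hT : DifferentiableAt ℝ (T S) p) (hTc : DifferentiableAt ℝ (cc (T S)) p) :
    lieD S p z r w w' (β1 S) =
    z * pdZ (T S) p + r * pdR (T S) p + w * pdW (T S) p + w' * pdWc (T S) p := by
  refine (lieD_β dR hT hTc).trans ?_
  rw [cev_coordVec_fderiv]
  ring

end lie

/-! ### The fiber equations -/

section fiber
variable {U : Set J6} {S : J6 → ℂ} {q : TetradParams} {p : J6}

theorem differentiableAt_of_contDiffOn {F : Type*} [NormedAddCommGroup F] [NormedSpace ℝ F]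
    {f : J6 → F} (hU : IsOpen U) (hf : ContDiffOn ℝ ∞ f U) (hp : p ∈ U) :
    DifferentiableAt ℝ f p :=
  (hf.contDiffAt (hU.mem_nhds hp)).differentiableAt (by simp)

theorem cev_vecD_β (S : J6 → ℂ) (p : J6) : cev (vecD S p) (β0 p) = 0 ∧
    cev (vecD S p) (βp S p) = 0 ∧ cev (vecD S p) (βm S p) = 0 ∧ cev (vecD S p) (β1 S p) = 0 := by
  rw [vecD, cev_β0, cev_βp, cev_βm, cev_β1]
  refine ⟨?_, ?_, ?_, ?_⟩ <;> ring

theorem lieD_tetrad (hU : IsOpen U) (hS : ContDiffOn ℝ ∞ S U)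
    (hineq : ∀ p ∈ U, 0 < 1 - Complex.normSq (pdR S p)) (hq : q.IsAdmissible U) (hp : p ∈ U)
    (z r w w' : ℂ) :
    lieD S p z r w w' (tetrad S q 0) = toC q.Φ p * w + D S (toC q.Φ) p * z ∧
    lieD S p z r w w' (tetrad S q 1) = toC q.Φ p *
      ((z * pdZ (T S) p + r * pdR (T S) p + w * pdW (T S) p + w' * pdWc (T S) p)
        + (q.a p * (z * pdZ S p + r * pdR S p + w * pdW S p + w' * pdWc S p) + D S q.a p * w)
        + (conj (q.a p) * r + D S (cc q.a) p * w') + (toC q.c p * w + D S (toC q.c) p * z))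
      + D S (toC q.Φ) p * (r + q.a p * w + conj (q.a p) * w' + toC q.c p * z) ∧
    lieD S p z r w w' (tetrad S q 2) = toC q.Φ p * toC q.α p *
      ((z * pdZ S p + r * pdR S p + w * pdW S p + w' * pdWc S p)
        + (q.b p * r + D S q.b p * w'))
      + (toC q.Φ p * D S (toC q.α) p + D S (toC q.Φ) p * toC q.α p) * (w + q.b p * w') ∧
    lieD S p z r w w' (tetrad S q 3) = toC q.Φ p * toC q.α p *
      (r + (conj (q.b p) * (z * pdZ S p + r * pdR S p + w * pdW S p + w' * pdWc S p)
        + D S (cc q.b) p * w))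
      + (toC q.Φ p * D S (toC q.α) p + D S (toC q.Φ) p * toC q.α p) * (w' + conj (q.b p) * w) := by
  have hT := contDiffOn_T hU hS hineq
  have dβ0 : DifferentiableAt ℝ β0 p := differentiableAt_of_contDiffOn hU
    (contDiffOn_β _ contDiffOn_cW contDiffOn_conj_cW) hp
  have dβp : DifferentiableAt ℝ (βp S) p := differentiableAt_of_contDiffOn hU
    (contDiffOn_β _ hS contDiffOn_cR) hp
  have dβm : DifferentiableAt ℝ (βm S) p := differentiableAt_of_contDiffOn hU
    (contDiffOn_β _ contDiffOn_cR (contDiffOn_cc hS)) hp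
  have dβ1 : DifferentiableAt ℝ (β1 S) p := differentiableAt_of_contDiffOn hU
    (contDiffOn_β _ hT (contDiffOn_cc hT)) hp
  have dΦ := differentiableAt_of_contDiffOn hU (contDiffOn_toC hq.smooth_Φ) hp
  have dα := differentiableAt_of_contDiffOn hU (contDiffOn_toC hq.smooth_α) hp
  have dc := differentiableAt_of_contDiffOn hU (contDiffOn_toC hq.smooth_c) hp
  have da := differentiableAt_of_contDiffOn hU hq.smooth_a hp
  have db := differentiableAt_of_contDiffOn hU hq.smooth_b hp
  have dac : DifferentiableAt ℝ (fun x => conj (q.a x)) p :=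
    differentiableAt_of_contDiffOn hU (contDiffOn_cc hq.smooth_a) hp
  have dbc : DifferentiableAt ℝ (fun x => conj (q.b x)) p :=
    differentiableAt_of_contDiffOn hU (contDiffOn_cc hq.smooth_b) hp
  have dS := differentiableAt_of_contDiffOn hU hS hp
  have dSc := differentiableAt_of_contDiffOn hU (contDiffOn_cc hS) hp
  have dT := differentiableAt_of_contDiffOn hU hT hp
  have dTc := differentiableAt_of_contDiffOn hU (contDiffOn_cc hT) hp
  obtain ⟨v0, vp, vm, v1⟩ := cev_vecD_β S p
  refine ⟨?_, ?_, ?_, ?_⟩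
  · rw [tetrad_zero, lieD_smul dΦ dβ0 v0, lieD_β0, cev_β0]
    ring
  · have e1 := dβ1.fun_add (da.fun_smul dβp)
    have e2 := e1.fun_add (dac.fun_smul dβm)
    have e3 := e2.fun_add (dc.fun_smul dβ0)
    rw [tetrad_one, lieD_smul dΦ e3 (by simp only [cev_clm_add, cev_clm_smul, v0, vp, vm, v1]; ring),
      lieD_add e2 (dc.fun_smul dβ0), lieD_add e1 (dac.fun_smul dβm), lieD_add dβ1 (da.fun_smul dβp),
      lieD_smul da dβp vp, lieD_smul dac dβm vm, lieD_smul dc dβ0 v0, lieD_β0, lieD_βp dS,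
      lieD_βm dSc, lieD_β1 dT dTc]
    simp only [cev_clm_add, cev_clm_smul, cev_β0, cev_βp, cev_βm, cev_β1]
    rw [show D S (fun x => conj (q.a x)) p = D S (cc q.a) p from rfl]
    ring
  · have e1 := dβp.fun_add (db.fun_smul dβm)
    rw [tetrad_two, lieD_smul (dΦ.fun_mul dα) e1
      (by simp only [cev_clm_add, cev_clm_smul, vp, vm]; ring),
      lieD_add dβp (db.fun_smul dβm), lieD_smul db dβm vm, lieD_βp dS, lieD_βm dSc, D_mul dΦ dα]
    simp only [cev_clm_add, cev_clm_smul, cev_βp, cev_βm]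
    ring
  · have e1 := dβm.fun_add (dbc.fun_smul dβp)
    rw [tetrad_three, lieD_smul (dΦ.fun_mul dα) e1
      (by simp only [cev_clm_add, cev_clm_smul, vp, vm]; ring),
      lieD_add dβm (dbc.fun_smul dβp), lieD_smul dbc dβp vp, lieD_βp dS, lieD_βm dSc, D_mul dΦ dα]
    simp only [cev_clm_add, cev_clm_smul, cev_βp, cev_βm]
    rw [show D S (fun x => conj (q.b x)) p = D S (cc q.b) p from rfl]
    ring

/-- The degenerate metric of the tetrad is conformally invariant along `D`. -/
theorem conformal_along_D {Γ : Fin 4 → Fin 4 → OneForm} {A : OneForm}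
    (h : IsTorsionFreeWeyl U (tetrad S q) Γ A) (hp : p ∈ U) (z r w w' : ℂ) :
    let V := coordVec z r w w' 0 0
    cev V (tetrad S q 0 p) * lieD S p z r w w' (tetrad S q 1)
      + cev V (tetrad S q 1 p) * lieD S p z r w w' (tetrad S q 0)
      - cev V (tetrad S q 2 p) * lieD S p z r w w' (tetrad S q 3)
      - cev V (tetrad S q 3 p) * lieD S p z r w w' (tetrad S q 2)
      = -cev (vecD S p) (A p) * (2 * cev V (tetrad S q 0 p) * cev V (tetrad S q 1 p)
        - 2 * cev V (tetrad S q 2 p) * cev V (tetrad S q 3 p)) := by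
  intro V
  have ht : ∀ i, lieD S p z r w w' (tetrad S q i) +
      ∑ k, η i k * ∑ j, cev (vecD S p) (Γ k j p) * cev V (tetrad S q j p) = 0 := by
    intro i
    have h1 := cev2_torsion (S := S) (q := q) (p := p) (vecD S p) V i Γ
    simp only [h.torsion_free p hp i, cev_vecD_tetrad, mul_zero, sub_zero] at h1
    rw [lieD, ← h1]
    simp [cev2]
  have hw : ∀ i j, cev (vecD S p) (Γ i j p) + cev (vecD S p) (Γ j i p) =
      2 * η i j * cev (vecD S p) (A p) := by
    intro i j
    have := congrArg (fun φ : J6 →L[ℝ] ℂ => cev (vecD S p) φ) (h.weyl p hp i j)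
    simp only [cev_clm_smul, cev_clm_add] at this
    linear_combination 2 * this
  have t0 := ht 0
  have t1 := ht 1
  have t2 := ht 2
  have t3 := ht 3
  have w00 := hw 0 0
  have w01 := hw 0 1
  have w02 := hw 0 2
  have w03 := hw 0 3
  have w11 := hw 1 1
  have w12 := hw 1 2
  have w13 := hw 1 3
  have w22 := hw 2 2
  have w23 := hw 2 3
  have w33 := hw 3 3
  simp [η, Fin.sum_univ_four] at t0 t1 t2 t3
  simp [η] at w00 w01 w02 w03 w11 w12 w13 w22 w23 w33
  generalize cev V (tetrad S q 0 p) = x0 at *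
  generalize cev V (tetrad S q 1 p) = x1 at *
  generalize cev V (tetrad S q 2 p) = x2 at *
  generalize cev V (tetrad S q 3 p) = x3 at *
  -- Contracting `L_D θ^i` with `η_ij θ^j` leaves the quadratic form `ω_ij(D) θ^i θ^j`, which sees
  -- only the symmetric part of `ω_ij(D)`.
  linear_combination x0 * t1 + x1 * t0 - x2 * t3 - x3 * t2 - x0 ^ 2 * w00 - x1 ^ 2 * w11
    - x2 ^ 2 * w22 - x3 ^ 2 * w33 - x0 * x1 * w01 - x0 * x2 * w02 - x0 * x3 * w03
    - x1 * x2 * w12 - x1 * x3 * w13 - x2 * x3 * w23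

/-- The equations that conformal invariance along `D` imposes on the tetrad parameters. -/
structure FiberEquations (S : J6 → ℂ) (q : TetradParams) (p : J6) (l : ℂ) : Prop where
  eq_Rp : 1 - toC q.α p ^ 2 * (1 + q.b p * conj (q.b p) + 2 * conj (q.b p) * pdR S p) = 0
  eq_Rm : toC q.α p ^ 2 * ((1 + q.b p * conj (q.b p)) * pdR S p + 2 * q.b p) = 0
  eq_pp : q.a p - toC q.α p ^ 2 * (2 * conj (q.b p) * pdW S p + D S (cc q.b) p)
    - 2 * toC q.α p * D S (toC q.α) p * conj (q.b p) + l * toC q.α p ^ 2 * conj (q.b p) = 0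
  eq_mm : toC q.α p ^ 2 * ((1 + q.b p * conj (q.b p)) * pdWc S p + D S q.b p)
    + 2 * toC q.α p * D S (toC q.α) p * q.b p - l * toC q.α p ^ 2 * q.b p = 0
  eq_pm : conj (q.a p) - toC q.α p ^ 2 * (2 * conj (q.b p) * pdWc S p
      + (1 + q.b p * conj (q.b p)) * pdW S p
      + (conj (q.b p) * D S q.b p + q.b p * D S (cc q.b) p))
    - 2 * toC q.α p * D S (toC q.α) p * (1 + q.b p * conj (q.b p))
    + l * toC q.α p ^ 2 * (1 + q.b p * conj (q.b p)) = 0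
  eq_Zp : pdW (T S) p + D S q.a p + q.a p * pdW S p + 2 * toC q.c p
    - 2 * toC q.α p ^ 2 * conj (q.b p) * pdZ S p = l * q.a p

theorem exists_fiberEquations (hU : IsOpen U) (hS : ContDiffOn ℝ ∞ S U)
    (hineq : ∀ p ∈ U, 0 < 1 - Complex.normSq (pdR S p)) (hq : q.IsAdmissible U)
    (htf : ∃ (Γ : Fin 4 → Fin 4 → OneForm) (A : OneForm), IsTorsionFreeWeyl U (tetrad S q) Γ A)
    (hp : p ∈ U) : ∃ l, FiberEquations S q p l := by
  obtain ⟨Γ, A, h⟩ := htf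
  have hΦ : toC q.Φ p ≠ 0 := by simpa [toC] using hq.Φ_ne p hp
  -- The logarithmic derivative of `Φ` along `D` only shifts the unknown `A(D)`. Both are absorbed
  -- in `l`, so `Φ` disappears from the fiber equations.
  obtain ⟨m, hm⟩ : ∃ m, D S (toC q.Φ) p = toC q.Φ p * m :=
    ⟨D S (toC q.Φ) p / toC q.Φ p, by field_simp⟩
  have key : ∀ z r w w' : ℂ,
      z * ((z * pdZ (T S) p + r * pdR (T S) p + w * pdW (T S) p + w' * pdWc (T S) p)
        + (q.a p * (z * pdZ S p + r * pdR S p + w * pdW S p + w' * pdWc S p) + D S q.a p * w)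
        + (conj (q.a p) * r + D S (cc q.a) p * w') + (toC q.c p * w + D S (toC q.c) p * z))
      + (r + q.a p * w + conj (q.a p) * w' + toC q.c p * z) * w
      - toC q.α p ^ 2 * ((w + q.b p * w') *
        (r + (conj (q.b p) * (z * pdZ S p + r * pdR S p + w * pdW S p + w' * pdWc S p)
          + D S (cc q.b) p * w))
        + (w' + conj (q.b p) * w) *
        ((z * pdZ S p + r * pdR S p + w * pdW S p + w' * pdWc S p)
          + (q.b p * r + D S q.b p * w')))
      - 2 * toC q.α p * D S (toC q.α) p * ((w + q.b p * w') * (w' + conj (q.b p) * w))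
      = -2 * (cev (vecD S p) (A p) + m) *
        (z * (r + q.a p * w + conj (q.a p) * w' + toC q.c p * z)
        - toC q.α p ^ 2 * ((w + q.b p * w') * (w' + conj (q.b p) * w))) := by
    intro z r w w'
    have hc := conformal_along_D h hp z r w w'
    obtain ⟨l0, l1, l2, l3⟩ := lieD_tetrad hU hS hineq hq hp z r w w'
    simp only [l0, l1, l2, l3, cev_tetrad_zero, cev_tetrad_one, cev_tetrad_two, cev_tetrad_three,
      hm] at hc
    refine mul_left_cancel₀ (pow_ne_zero 2 hΦ) ?_
    linear_combination hc
  -- `key` is an identity of quadratic forms in `z, r, w, w'`. Mixed coefficients come from values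
  -- at sums of coordinate vectors minus the pure squares; the `r²` coefficient is zero on both
  -- sides and needs no subtraction.
  have kw := key 0 0 1 0
  have kw' := key 0 0 0 1
  have kz := key 1 0 0 0
  refine ⟨-2 * (cev (vecD S p) (A p) + m), ⟨?_, ?_, ?_, ?_, ?_, ?_⟩⟩
  · linear_combination key 0 1 1 0 - kw
  · linear_combination kw' - key 0 1 0 1
  · linear_combination kw
  · linear_combination -kw'
  · linear_combination key 0 0 1 1 - kw - kw'
  · linear_combination key 1 0 1 0 - kw - kz

end fiber

/-! ### The tetrad parameters -/

theorem one_add_mul_conj_ne (b : ℂ) : 1 + b * conj b ≠ 0 := by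
  rw [Complex.mul_conj]
  have := Complex.normSq_nonneg b
  exact_mod_cast (by positivity : (1 + Complex.normSq b) ≠ 0)

theorem one_add_add_sq_ne (b : ℂ) : 1 + b * conj b + (b * conj b) ^ 2 ≠ 0 := by
  rw [Complex.mul_conj]
  have := Complex.normSq_nonneg b
  exact_mod_cast (by positivity : (1 + Complex.normSq b + Complex.normSq b ^ 2) ≠ 0)

/-! ### The two roots of the equation for `b`. -/

section root
variable {S : J6 → ℂ} {p : J6} {b : ℂ}

/-- With `n = |b|²`, taking squared moduli gives `|S_R|² = 4n/(1+n)²`, and `(1+n)² - 4n = (1-n)²`.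
The sign hidden in the absolute value is what distinguishes the branches. -/
theorem rootS_eq (h : (1 + b * conj b) * pdR S p = -2 * b) :
    rootS S p = ((|1 - Complex.normSq b| / (1 + Complex.normSq b) : ℝ) : ℂ) := by
  have h1 := congrArg Complex.normSq h
  have h0 := Complex.normSq_nonneg b
  have h2 : 1 + b * conj b = ((1 + Complex.normSq b : ℝ) : ℂ) := by
    rw [Complex.mul_conj]; push_cast; rfl
  rw [h2, Complex.normSq_mul, Complex.normSq_mul, Complex.normSq_ofReal, Complex.normSq_neg,
    Complex.normSq_ofNat] at h1
  have h3 : 1 - Complex.normSq (pdR S p) =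
      (|1 - Complex.normSq b| / (1 + Complex.normSq b)) ^ 2 := by
    rw [div_pow, sq_abs, eq_div_iff (by positivity)]
    linear_combination -h1
  rw [rootS, h3, Real.sqrt_sq (by positivity)]

theorem bPlus_eq_of_norm_lt (hpos : 0 < 1 - Complex.normSq (pdR S p))
    (h : (1 + b * conj b) * pdR S p = -2 * b) (hb : ‖b‖ < 1) : bPlus S p = b := by
  have hn : Complex.normSq b ≤ 1 := by
    rw [Complex.normSq_eq_norm_sq]
    exact (sq_lt_one_iff₀ (norm_nonneg b)).2 hb |>.le
  have hr := one_add_mul_conj_ne b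
  rw [bPlus_eq S p hpos, rootS_eq h, abs_of_nonneg (by linarith)]
  push_cast
  rw [← Complex.mul_conj]
  have h2 : 1 + (1 - b * conj b) / (1 + b * conj b) = 2 / (1 + b * conj b) := by
    field_simp; ring
  rw [h2, div_div_eq_mul_div, div_eq_iff two_ne_zero]
  linear_combination -h

/-- The roots have product `S_R/S*_R = b/b*`, since `S_R` is a real multiple of `b`. So the root
other than `b` is `1/b*`. -/
theorem bPlus_eq_of_one_lt_norm (hpos : 0 < 1 - Complex.normSq (pdR S p))
    (h : (1 + b * conj b) * pdR S p = -2 * b) (hb : 1 < ‖b‖) :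
    bPlus S p = (conj b)⁻¹ ∧ pdR S p ≠ 0 ∧ bMinus S p = b := by
  have hn : 1 ≤ Complex.normSq b := by
    rw [Complex.normSq_eq_norm_sq]
    exact (one_lt_sq_iff₀ (norm_nonneg b)).2 hb |>.le
  have hr := one_add_mul_conj_ne b
  have hb0 : b ≠ 0 := by
    rintro rfl
    simp at hb
    linarith
  have hbc : conj b ≠ 0 := by simpa using hb0
  have hR : pdR S p ≠ 0 := by
    intro h0
    rw [h0, mul_zero] at h
    exact mul_ne_zero (by norm_num) hb0 h.symm
  have hRc : conj (pdR S p) ≠ 0 := by simpa using hR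
  have hc : (1 + b * conj b) * conj (pdR S p) = -2 * conj b := by
    have := congrArg conj h
    simp only [map_mul, map_add, map_one, map_neg, Complex.conj_conj, map_ofNat] at this
    linear_combination this
  have hroot : rootS S p = (b * conj b - 1) / (1 + b * conj b) := by
    rw [rootS_eq h, abs_of_nonpos (by linarith)]
    push_cast
    rw [← Complex.mul_conj]
    ring
  refine ⟨?_, hR, ?_⟩
  · rw [bPlus_eq S p hpos, hroot]
    have h2 : 1 + (b * conj b - 1) / (1 + b * conj b) = 2 * (b * conj b) / (1 + b * conj b) := by
      field_simp; ring
    rw [h2, div_div_eq_mul_div, div_eq_iff (by simp [hb0])]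
    field_simp
    linear_combination -h
  · rw [bMinus, hroot, div_eq_iff hRc]
    refine mul_left_cancel₀ hr ?_
    rw [mul_sub, mul_div_cancel₀ _ hr]
    linear_combination -b * hc

end root

/-! ### Solving the fiber equations for `α`, `a`, `c` and comparing the two branches. -/

section parameters
variable {U : Set J6} {S : J6 → ℂ} {q : TetradParams} {p : J6} {l : ℂ}

theorem FiberEquations.pdR_eq (h : FiberEquations S q p l) (hα : toC q.α p ≠ 0) :
    (1 + q.b p * conj (q.b p)) * pdR S p = -2 * q.b p := by
  have := (mul_eq_zero.1 h.eq_Rm).resolve_left (pow_ne_zero 2 hα)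
  linear_combination this

theorem FiberEquations.sq_α_mul (h : FiberEquations S q p l) (hα : toC q.α p ≠ 0) :
    toC q.α p ^ 2 * (1 - q.b p * conj (q.b p)) ^ 2 = 1 + q.b p * conj (q.b p) := by
  linear_combination -(1 + q.b p * conj (q.b p)) * h.eq_Rp
    - 2 * toC q.α p ^ 2 * conj (q.b p) * h.pdR_eq hα

/-- The relation for `α²` holds on an open set, so it may be differentiated; this supplies the
derivative of `α` occurring in the fiber equations. -/
theorem D_sq_α (hU : IsOpen U) (hq : q.IsAdmissible U) (hp : p ∈ U)
    (h : ∀ p ∈ U, toC q.α p ^ 2 * (1 - q.b p * conj (q.b p)) ^ 2 = 1 + q.b p * conj (q.b p)) :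
    2 * toC q.α p * D S (toC q.α) p * (1 - q.b p * conj (q.b p)) ^ 2
      - 2 * toC q.α p ^ 2 * (1 - q.b p * conj (q.b p))
        * (conj (q.b p) * D S q.b p + q.b p * D S (cc q.b) p)
      = conj (q.b p) * D S q.b p + q.b p * D S (cc q.b) p := by
  have dα := differentiableAt_of_contDiffOn hU (contDiffOn_toC hq.smooth_α) hp
  have db := differentiableAt_of_contDiffOn hU hq.smooth_b hp
  have dbc := differentiableAt_of_contDiffOn hU (contDiffOn_cc hq.smooth_b) hp
  have dN : DifferentiableAt ℝ (fun x => 1 + -1 * (q.b x * cc q.b x)) p :=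
    ((db.fun_mul dbc).const_mul (-1)).const_add 1
  have hN : D S (fun x => 1 + -1 * (q.b x * cc q.b x)) p =
      -(q.b p * D S (cc q.b) p + D S q.b p * conj (q.b p)) := by
    rw [D_add (differentiableAt_const 1) ((db.fun_mul dbc).const_mul (-1)), D_const,
      D_mul (differentiableAt_const (-1)) (db.fun_mul dbc), D_const, D_mul db dbc]
    simp only [cc]
    ring
  -- With `N = 1 - bb*` the relation becomes `α²N² + N = 2`, whose right-hand side has zero
  -- derivative.
  have hev : (fun x => toC q.α x * toC q.α x * ((1 + -1 * (q.b x * cc q.b x)) *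
      (1 + -1 * (q.b x * cc q.b x))) + (1 + -1 * (q.b x * cc q.b x))) =ᶠ[nhds p]
      fun _ => (2 : ℂ) := by
    filter_upwards [hU.mem_nhds hp] with x hx
    simp only [cc]
    linear_combination h x hx
  have hD := D_congr (S := S) hev
  rw [D_const, D_add ((dα.fun_mul dα).fun_mul (dN.fun_mul dN)) dN,
    D_mul (dα.fun_mul dα) (dN.fun_mul dN),
    D_mul dα dα, D_mul dN dN, hN] at hD
  simp only [cc] at hD
  linear_combination hD

theorem conj_toC (f : J6 → ℝ) (p : J6) : conj (toC f p) = toC f p := Complex.conj_ofReal _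

theorem FiberEquations.solution (h : FiberEquations S q p l) (hα : toC q.α p ≠ 0)
    (hb : q.b p * conj (q.b p) ≠ 1) (db : DifferentiableAt ℝ q.b p)
    (dbc : DifferentiableAt ℝ (cc q.b) p)
    (hD : 2 * toC q.α p * D S (toC q.α) p * (1 - q.b p * conj (q.b p)) ^ 2
      - 2 * toC q.α p ^ 2 * (1 - q.b p * conj (q.b p))
        * (conj (q.b p) * D S q.b p + q.b p * D S (cc q.b) p)
      = conj (q.b p) * D S q.b p + q.b p * D S (cc q.b) p) :
    wunschmann S q.b p = 0 ∧ q.a p = aRegular S q.b p ∧ (q.b p ≠ 0 → q.a p = aFormula S q.b p) ∧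
      toC q.c p = cFormula S q.b q.a p := by
  have hm : 1 - q.b p * conj (q.b p) ≠ 0 := sub_ne_zero.2 hb.symm
  have hr := one_add_mul_conj_ne (q.b p)
  have h0 := h.sq_α_mul hα
  have e := fiber_elimination h0 hD h.eq_pp h.eq_mm h.eq_pm hm
  obtain ⟨i1, i2, i3⟩ := e
  -- Since `l` is already eliminated from `i1` and `i2`, their conjugates bring in no new unknown;
  -- no reality of `A` is needed.
  have c1 := congrArg conj i1
  have c2 := congrArg conj i2
  have cz := congrArg conj h.eq_Zp
  simp only [map_mul, map_add, map_sub, map_one, map_pow, Complex.conj_conj, map_ofNat,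
    conj_toC, ← Dc_cc, cc_cc, ← pdW_cc, ← pdWc_cc, ← pdZ_cc] at c1 c2 cz
  obtain ⟨s1, s2, s3, s4, s5⟩ := fiber_solution (a := q.a p) (a' := conj (q.a p))
    (Y := Dc S q.b p) (X := Dc S (cc q.b) p) (W := pdWc (cc S) p) (V := pdW (cc S) p)
    hm hr (one_add_add_sq_ne (q.b p)) i1 i2
    (by linear_combination c1) (by linear_combination c2)
  refine ⟨?_, ?_, fun hb0 => ?_, ?_⟩
  · rw [wunschmann, s1, zero_div]
  · rw [aRegular, eq_div_iff (pow_ne_zero 3 hm), Dc_mul db dbc]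
    simp only [cc] at s3 ⊢
    linear_combination s3
  · have hbc : conj (q.b p) ≠ 0 := by simpa using hb0
    rw [aFormula]
    field_simp
    linear_combination s4
  -- This determines `l`: `i3` contains `l` and the derivative of `bb*`, and `s5` expresses that
  -- derivative through `a`, `a*` and `S_{W*}`.
  · have k1 : (1 + q.b p * conj (q.b p)) ^ 2 * (l - pdW S p) =
        4 * (1 + q.b p * conj (q.b p)) * q.b p * q.a p
        - 2 * (1 + q.b p * conj (q.b p)) * conj (q.b p) * pdWc S p
        - (1 + 6 * (q.b p * conj (q.b p)) + (q.b p * conj (q.b p)) ^ 2) * conj (q.a p) := by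
      refine mul_left_cancel₀ (pow_ne_zero 2 hm) ?_
      linear_combination (1 - q.b p * conj (q.b p)) * i3 + 4 * s5
    have hA : toC q.α p ^ 2 = (1 + q.b p * conj (q.b p)) / (1 - q.b p * conj (q.b p)) ^ 2 := by
      rw [eq_div_iff (pow_ne_zero 2 hm), h0]
    have k1' : l = pdW S p + 4 * q.b p * q.a p / (1 + q.b p * conj (q.b p))
        - 2 * conj (q.b p) * pdWc S p / (1 + q.b p * conj (q.b p))
        - (1 + 6 * (q.b p * conj (q.b p)) + (q.b p * conj (q.b p)) ^ 2) * conj (q.a p)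
        / (1 + q.b p * conj (q.b p)) ^ 2 := by
      field_simp
      linear_combination k1
    have k2' := congrArg conj k1'
    simp only [map_mul, map_add, map_sub, map_one, map_pow, map_div₀, Complex.conj_conj, map_ofNat,
      ← pdW_cc, ← pdWc_cc] at k2'
    have hz := h.eq_Zp
    rw [hA, k1'] at hz
    rw [hA, k2'] at cz
    simp only [cFormula, div_mul_eq_div_div]
    -- The real `c` enters `eq_Zp` and its conjugate with coefficient `2` each; their sum gives `4c`
    -- and the symmetric form of the formula.
    linear_combination (1 / 4) * hz + (1 / 4) * cz

/-- The generalized invariant changes by a factor when it is built from the other root. -/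
theorem wunschmann_inv_conj {b : J6 → ℂ} (db : DifferentiableAt ℝ (cc b) p) (hb : b p ≠ 0)
    (h : wunschmann S b p = 0) (hne : b p * conj (b p) ≠ 1) :
    wunschmann S (fun x => (conj (b x))⁻¹) p = 0 := by
  have hbc : cc b p ≠ 0 := by simpa [cc] using hb
  have hm : 1 - b p * conj (b p) ≠ 0 := sub_ne_zero.2 hne.symm
  have hinv : DifferentiableAt ℝ (fun x => (cc b x)⁻¹) p := db.fun_inv hbc
  -- Differentiating `(1/b*) b* = 1` gives the derivatives of `1/b*` along `D` and `D*`.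
  have hev : (fun x => (cc b x)⁻¹ * cc b x) =ᶠ[nhds p] fun _ => (1 : ℂ) := by
    filter_upwards [db.continuousAt.eventually_ne hbc] with x hx
    exact inv_mul_cancel₀ hx
  have h1 := D_congr (S := S) hev
  have h2 := Dc_congr (S := S) hev
  rw [D_const, D_mul hinv db] at h1
  rw [Dc_const, Dc_mul hinv db, Dc_cc] at h2
  rw [wunschmann, div_eq_zero_iff, or_iff_left hm] at h
  have hc := congrArg conj h
  simp only [map_mul, map_add, map_sub, map_pow, map_zero, ← Dc_cc, ← D_cc, ← pdW_cc, ← pdWc_cc,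
    cc_cc] at hc
  rw [Dc_cc] at hc
  have e1 : D S (fun x => (conj (b x))⁻¹) p = -(conj (b p))⁻¹ ^ 2 * D S (cc b) p := by
    refine mul_right_cancel₀ hbc ?_
    simp only [cc] at h1 hbc ⊢
    field_simp at h1 ⊢
    linear_combination h1
  have e2 : Dc S (fun x => (conj (b x))⁻¹) p = -(conj (b p))⁻¹ ^ 2 * conj (D S b p) := by
    refine mul_right_cancel₀ hbc ?_
    simp only [cc] at h2 hbc ⊢
    field_simp at h2 ⊢
    linear_combination h2
  have hbc' : conj (b p) ≠ 0 := hbc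
  rw [wunschmann, div_eq_zero_iff]
  left
  rw [e1, e2]
  -- The numerator formed with `1/b*` equals `-(b*)⁻³` times the conjugate of the numerator formed
  -- with `b`.
  field_simp
  linear_combination -hc

theorem wunschmann_congr {b b' : J6 → ℂ} (h : b =ᶠ[nhds p] b') :
    wunschmann S b p = wunschmann S b' p := by
  rw [wunschmann, wunschmann, D_congr h, Dc_congr h, h.eq_of_nhds]

end parameters

end PairPDE

theorem theorem2 (U : Set J6) (hU : IsOpen U) (S : J6 → ℂ) (hS : ContDiffOn ℝ ∞ S U)
    (hineq : ∀ p ∈ U, 0 < 1 - Complex.normSq (pdR S p))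
    (hint : ∀ p ∈ U, D S (D S (cc S)) p = Dc S (Dc S S) p)
    (q : TetradParams) (hq : q.IsAdmissible U)
    (htf : ∃ (Γ : Fin 4 → Fin 4 → OneForm) (A : OneForm),
      IsTorsionFreeWeyl U (tetrad S q) Γ A) :
    -- the connection is determined by the structure coefficients and the free components of `A`
    (∃ Δ : Fin 4 → Fin 6 → Fin 6 → J6 → ℂ, IsStructureCoeff U S q Δ ∧
      ∀ (A4 : Fin 4 → J6 → ℂ) (Γ : Fin 4 → Fin 4 → OneForm) (A : OneForm),
        (IsTorsionFreeWeyl U (tetrad S q) Γ A ∧ HasSpacetimePart U S q A A4) ↔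
          ∀ p ∈ U, (∀ i j, Γ i j p = connForm S q Δ A4 i j p) ∧ A p = weylForm S q Δ A4 p) ∧
    -- the tetrad parameters
    (∀ p ∈ U,
      (q.b p = bPlus S p ∨ (pdR S p ≠ 0 ∧ q.b p = bMinus S p)) ∧
      (‖q.b p‖ < 1 → q.b p = bPlus S p) ∧
      (q.α p : ℂ) ^ 2 = (1 + q.b p * conj (q.b p)) / (1 - q.b p * conj (q.b p)) ^ 2 ∧
      q.a p = aRegular S q.b p ∧
      (q.b p ≠ 0 → q.a p = aFormula S q.b p) ∧
      (q.c p : ℂ) = cFormula S q.b q.a p) ∧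
    -- the generalized invariant vanishes
    (∀ p ∈ U, wunschmann S (bPlus S) p = 0) := by
  have hα : ∀ p ∈ U, toC q.α p ≠ 0 := fun p hp => by simpa [toC] using hq.α_ne p hp
  choose l hl using fun p (hp : p ∈ U) => exists_fiberEquations hU hS hineq hq htf hp
  have hR := fun p hp => (hl p hp).pdR_eq (hα p hp)
  have hsq := fun p hp => (hl p hp).sq_α_mul (hα p hp)
  have db := fun p hp => differentiableAt_of_contDiffOn (p := p) hU hq.smooth_b hp
  have dbc := fun p hp => differentiableAt_of_contDiffOn (p := p) hU (contDiffOn_cc hq.smooth_b) hp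
  have hsol := fun p hp => (hl p hp).solution (hα p hp) (hq.b_ne p hp) (db p hp) (dbc p hp)
    (D_sq_α hU hq hp hsq)
  have hnorm : ∀ p ∈ U, ‖q.b p‖ < 1 ∨ 1 < ‖q.b p‖ := by
    intro p hp
    refine lt_or_gt_of_ne fun h => hq.b_ne p hp ?_
    rw [Complex.mul_conj, Complex.normSq_eq_norm_sq, h]
    norm_num
  refine ⟨⟨structureCoeff S q, isStructureCoeff hU hS hineq hq,
    weyl_connection_unique hq htf⟩, fun p hp => ⟨?_, ?_, ?_, ?_, ?_, ?_⟩, fun p hp => ?_⟩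
  · rcases hnorm p hp with h | h
    · exact Or.inl (bPlus_eq_of_norm_lt (hineq p hp) (hR p hp) h).symm
    · obtain ⟨-, h1, h2⟩ := bPlus_eq_of_one_lt_norm (hineq p hp) (hR p hp) h
      exact Or.inr ⟨h1, h2.symm⟩
  · exact fun h => (bPlus_eq_of_norm_lt (hineq p hp) (hR p hp) h).symm
  · rw [eq_div_iff (pow_ne_zero 2 (sub_ne_zero.2 (hq.b_ne p hp).symm))]
    exact hsq p hp
  · exact (hsol p hp).2.1
  · exact (hsol p hp).2.2.1
  · exact (hsol p hp).2.2.2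
  -- The invariant differentiates `b_+`, so `b_+` must be identified with `b` or `1/b*` near `p`;
  -- continuity of `|b|` keeps the branch fixed there.
  · have hcont : ContinuousAt (fun x => ‖q.b x‖) p := (db p hp).continuousAt.norm
    rcases hnorm p hp with h | h
    · have hev : bPlus S =ᶠ[nhds p] q.b := by
        filter_upwards [hU.mem_nhds hp, hcont.eventually_lt_const h] with x hx hx'
        exact bPlus_eq_of_norm_lt (hineq x hx) (hR x hx) hx'
      rw [wunschmann_congr hev]
      exact (hsol p hp).1
    · have hev : bPlus S =ᶠ[nhds p] fun x => (conj (q.b x))⁻¹ := by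
        filter_upwards [hU.mem_nhds hp, hcont.eventually_const_lt h] with x hx hx'
        exact (bPlus_eq_of_one_lt_norm (hineq x hx) (hR x hx) hx').1
      rw [wunschmann_congr hev]
      refine wunschmann_inv_conj (dbc p hp) ?_ (hsol p hp).1 (hq.b_ne p hp)
      exact norm_pos_iff.1 (zero_lt_one.trans h)
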